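/- **Setting.** Let $W\in C^3(\mathbb R)$ be strictly convex in the sense that $W''>0$ everywhere. Let $J$ be a nondegenerate interval with smallest element $0$ (for instance $J=[0,T]$ or $J=[0,\infty)$), and let $u\in C^3([0,1]\times J)$ satisfy $$\frac{u_t}{\sqrt{1+u_x^2}}=W''(u_x)\,u_{xx}\quad\text{on }[0,1]\times J,\qquad u(0,t)=u(1,t)=0,\qquad u_0:=u(\cdot,0).$$ **Crystalline approximation.** Let $S\subset\mathbb R$ be a locally finite set of admissible slopes (the abscissae of the corners of a piecewise linear function that coincides with $W$ at its corners). A crystalline approximation is a continuous function $u^m$ on $[0,1]\times J$ with $u^m(0,t)=u^m(1,t)=0$ such that, between finitely many event times, $u^m(\cdot,t)$ is continuous and piecewise linear with corners $0=x_0<x_1(t)<\dots<x_{N-1}(t)<x_N=1$ and faces $[x_{i-1},x_i]$ of length $l_i=x_i-x_{i-1}$ with constant slopes $s_i\in S$, $s_i\ne s_{i+1}$, and $$\dot x_i=-\frac{v_{i+1}-v_i}{s_{i+1}-s_i}\quad(1\le i\le N-1),\qquad v_1=v_N=0,$$ $$v_i=\sqrt{1+s_i^2}\,\frac{\Delta_i}{l_i},\qquad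 \Delta_i=\frac{W(s_{i+1})-W(s_i)}{s_{i+1}-s_i}-\frac{W(s_i)-W(s_{i-1})}{s_i-s_{i-1}}\quad(2\le i\le N-1).$$ At an event time the faces whose lengths have shrunk to zero are deleted, and neighbouring faces that then have equal slopes are joined; $u^m$ is continuous through event times. For the initial datum $u_0^m=u^m(\cdot,0)$, the slopes of neighbouring faces are adjacent elements of $S$. **Theorem.** There are $m_0>0$ and continuous functions $\Lambda,\Gamma:J\to\mathbb R$, depending only on $W$, $J$ and $u$, such that for every $0<m\le m_0$, every $S$ as above, and every crystalline approximation $u^m$ whose initial data satisfy $$\|(u_0^m)_x-(u_0)_x\|_{L^\infty(0,1)}\le m\qquad\text{and}\qquad |[(u_0^m)_x]_{i+1}-[(u_0^m)_x]_{i}|\le m\ \text{ for all neighbouring faces } i,i+1,$$ the function $$\Upsilon(t)=\frac12\int_0^1|u_x-u_x^m|^2\,dx$$ is continuous on $J$, is differentiable at every $t\in J$ that is not an event time (one-sidedly at endpoints of $J$), and satisfies at these times $$\frac{d\Upsilon}{dt}\le\Lambda(t)\,\Upsilon(t)+\Gamma(t)\,m .$$ Moreover, for every $T\in J$ there is a constant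 $C_T$, independent of $m$, $S$ and $u^m$, such that for all such $m$, $S$, $u^m$ $$\sup_{0\le t\le T}\|u-u^m\|_{H^1([0,1])}\le C_T\,m^{1/2}.$$ -/

import Mathlib

open Set

noncomputable section

namespace Crystalline

/-- `u_x(x,t)`, the derivative in `x ∈ [0,1]` (one-sided at the endpoints). -/
def spaceDeriv (u : ℝ → ℝ → ℝ) (x t : ℝ) : ℝ :=
  derivWithin (fun y => u y t) (Icc 0 1) x

/-- `u_t(x,t)`, the derivative in `t ∈ J` (one-sided at the endpoints of `J`). -/
def timeDeriv (J : Set ℝ) (u : ℝ → ℝ → ℝ) (x t : ℝ) : ℝ :=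
  derivWithin (fun s => u x s) J t

/-- `u` is a `C³` solution on `[0,1] × J` of `u_t / √(1 + u_x²) = W''(u_x) u_xx`
with `u(0,t) = u(1,t) = 0`. The initial datum is `u(·,0)`. -/
structure IsClassicalSolution (W : ℝ → ℝ) (J : Set ℝ) (u : ℝ → ℝ → ℝ) : Prop where
  contDiffOn : ContDiffOn ℝ 3 (fun p : ℝ × ℝ => u p.1 p.2) (Icc (0 : ℝ) 1 ×ˢ J)
  equation : ∀ x ∈ Icc (0 : ℝ) 1, ∀ t ∈ J,
    timeDeriv J u x t / Real.sqrt (1 + spaceDeriv u x t ^ 2)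
      = iteratedDeriv 2 W (spaceDeriv u x t) * spaceDeriv (spaceDeriv u) x t
  boundary_left : ∀ t ∈ J, u 0 t = 0
  boundary_right : ∀ t ∈ J, u 1 t = 0

/-- `a` and `b` are adjacent elements of `S`. -/
def Adjacent (S : Set ℝ) (a b : ℝ) : Prop :=
  a ∈ S ∧ b ∈ S ∧ a ≠ b ∧ ∀ c ∈ S, ¬ (min a b < c ∧ c < max a b)

/-- On `[0,1]` the function `f` is continuous and piecewise linear with exactly `N` faces
`i = 1, …, N`; the `i`-th face lies over `[x (i-1), x i]` and has slope `s i ∈ S`. Neighbouring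
faces have different slopes. Only `x 0, …, x N` and `s 1, …, s N` matter. -/
structure HasFaces (S : Set ℝ) (f : ℝ → ℝ) (N : ℕ) (s x : ℕ → ℝ) : Prop where
  pos : 1 ≤ N
  first : x 0 = 0
  last : x N = 1
  strict : ∀ i, i < N → x i < x (i + 1)
  slope_mem : ∀ i, 1 ≤ i → i ≤ N → s i ∈ S
  slope_ne : ∀ i, 1 ≤ i → i < N → s i ≠ s (i + 1)
  linear : ∀ i, i < N → ∀ y ∈ Icc (x i) (x (i + 1)), f y = f (x i) + s (i + 1) * (y - x i)

/-- `Δ_i`, the jump across face `i` of the difference quotients of `W`. -/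
def faceDelta (W : ℝ → ℝ) (s : ℕ → ℝ) (i : ℕ) : ℝ :=
  (W (s (i + 1)) - W (s i)) / (s (i + 1) - s i) - (W (s i) - W (s (i - 1))) / (s i - s (i - 1))

/-- The vertical velocity of face `i`: `√(1 + s_i²) Δ_i / l_i`, with `l_i = x_i - x_{i-1}`, for
`2 ≤ i ≤ N - 1`, and `0` for the two end faces. -/
def faceVelocity (W : ℝ → ℝ) (N : ℕ) (s x : ℕ → ℝ) (i : ℕ) : ℝ :=
  if 2 ≤ i ∧ i + 1 ≤ N then
    Real.sqrt (1 + s i ^ 2) * (faceDelta W s i / (x i - x (i - 1)))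
  else 0

/-- The crystalline evolution on the time interval `J` (with left endpoint `0`), for the energy `W`
and the set `S` of admissible slopes, that is, of abscissae of the corners of the piecewise linear
interpolant of `W`. At the finitely many times `eventTime 1 < ⋯ < eventTime K` the faces may
change; in the `k`-th epoch, which is `eventTime k ≤ t < eventTime (k + 1)` for `k < K` and
`eventTime K ≤ t` for `k = K`, there are `N k` faces, with constant slopes `slope k i` and moving
corners `corner k t i`. Continuity of `toFun` through the event times says that faces whose length
shrinks to zero are deleted, and neighbours that then have equal slopes are joined. -/
structure Flow (W : ℝ → ℝ) (S J : Set ℝ) where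
  toFun : ℝ → ℝ → ℝ
  K : ℕ
  eventTime : ℕ → ℝ
  N : ℕ → ℕ
  slope : ℕ → ℕ → ℝ
  corner : ℕ → ℝ → ℕ → ℝ
  eventTime_zero : eventTime 0 = 0
  eventTime_lt : ∀ k, k < K → eventTime k < eventTime (k + 1)
  continuousOn : ContinuousOn (fun p : ℝ × ℝ => toFun p.1 p.2) (Icc (0 : ℝ) 1 ×ˢ J)
  boundary_left : ∀ t ∈ J, toFun 0 t = 0
  boundary_right : ∀ t ∈ J, toFun 1 t = 0
  hasFaces : ∀ k, k ≤ K →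
    ∀ t ∈ {t ∈ J | eventTime k ≤ t ∧ (k < K → t < eventTime (k + 1))},
      HasFaces S (fun y => toFun y t) (N k) (slope k) (corner k t)
  /-- The corners move so that the faces keep their slopes and have the prescribed velocities. -/
  corner_deriv : ∀ k, k ≤ K →
    ∀ t ∈ {t ∈ J | eventTime k ≤ t ∧ (k < K → t < eventTime (k + 1))},
      ∀ i, 1 ≤ i → i < N k →
        HasDerivWithinAt (fun r => corner k r i)
          (-(faceVelocity W (N k) (slope k) (corner k t) (i + 1)
              - faceVelocity W (N k) (slope k) (corner k t) i)
            / (slope k (i + 1) - slope k i))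
          {t ∈ J | eventTime k ≤ t ∧ (k < K → t < eventTime (k + 1))} t
  /-- Initially, neighbouring slopes are adjacent admissible slopes. -/
  initial_adjacent : ∀ i, 1 ≤ i → i < N 0 → Adjacent S (slope 0 i) (slope 0 (i + 1))

/-- The initial data of the flow are `m`-close to those of `u`: the `L^∞` distance of the space
derivatives is at most `m` (the derivative of the flow exists except at the corners), and the slope
jumps of the flow are at most `m`. -/
structure InitiallyClose {W : ℝ → ℝ} {S J : Set ℝ} (u : ℝ → ℝ → ℝ) (U : Flow W S J) (m : ℝ) :
    Prop where
  slope_close : ∀ x ∈ Icc (0 : ℝ) 1,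
    DifferentiableWithinAt ℝ (fun y => U.toFun y 0) (Icc 0 1) x →
      |spaceDeriv U.toFun x 0 - spaceDeriv u x 0| ≤ m
  jump_le : ∀ i, 1 ≤ i → i < U.N 0 → |U.slope 0 (i + 1) - U.slope 0 i| ≤ m

/-- `Υ(t) = ½ ∫₀¹ |u_x - v_x|² dx`. -/
def upsilon (u v : ℝ → ℝ → ℝ) (t : ℝ) : ℝ :=
  (1 / 2) * ∫ x in (0 : ℝ)..1, |spaceDeriv u x t - spaceDeriv v x t| ^ 2

/-- The `H¹([0,1])` norm of a (piecewise `C¹`, continuous) function. -/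
def h1Norm (f : ℝ → ℝ) : ℝ :=
  Real.sqrt ((∫ x in (0 : ℝ)..1, f x ^ 2) + ∫ x in (0 : ℝ)..1, derivWithin f (Icc 0 1) x ^ 2)

end Crystalline

end

/-! The proof is a relative energy estimate. Between event times the slopes are constant, so
integration by parts turns Υ into ½∫u_x² plus a finite sum over the corners, which can be
differentiated in time. With p = u_x, a = u_xx and q = √(1+p²) W''(p), the equation reads u_t = q a.
By the mean value theorem for second divided differences, an inner face moves with velocity Q σ,
where Q = √(1+s²) W''(ξ) for some ξ near its slope s, and σ = (s_{i+1} - s_{i-1})/(2l) is its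
discrete curvature. Distributing the corner terms over the faces, the rate has on each inner face
the integrand -q a² + (q+Q) σ a - Q σ², up to O(m). This equals -Q(σ-a)² + (q-Q) a (σ-a), hence is
at most ((q-Q) a)²/(4Q); since |q-Q| ≤ K(|p-s| + m), the total is bounded by a multiple of Υ + m
(`quadratic_bound`, `inner_face_bound`, `rate_le`).

This needs the slopes to stay bounded and the jumps to stay at most m for all time, while both are
assumed only at time 0. The crux is that adjacency of neighbouring slopes in S survives event times
(`Flow.controlledSlopes_succ`). Within an epoch each face velocity has a fixed sign, so the corners
converge at its end. If a collapsing group of faces left two neighbouring slopes with an element of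
S strictly between them, the group would contain a face that is strictly convex (or, after
reflection, strictly concave). Its velocity would blow up as its length shrinks, pushing apart the
corners that are supposed to merge (`CornerMotion.not_collapse`).

Υ is continuous through event times by dominated convergence (`Flow.tendsto_upsilon_nhdsLT`), so
Grönwall's inequality applies across them, starting from Υ(0) ≤ m²/2; a Poincaré inequality then
gives the H¹ bound. The constants are uniform on each [0,T], and a partition of unity makes them
continuous functions of t. -/

noncomputable section

namespace Crystalline

open Filter Topology MeasureTheory

/-! ### Partial derivatives of the smooth solution up to the boundary, and the rate of its Dirichlet
energy -/

section Regularity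

variable {J : Set ℝ} {F u : ℝ → ℝ → ℝ}

/-- A nontrivial interval of the real line is a set of unique differentiability. -/
lemma uniqueDiffOn_of_ordConnected (hJ : J.OrdConnected) (hJnt : J.Nontrivial) :
    UniqueDiffOn ℝ J := by
  obtain ⟨a, ha, b, hb, hab⟩ := hJnt.exists_lt
  refine uniqueDiffOn_convex hJ.convex ⟨(a + b) / 2, ?_⟩
  exact interior_mono (hJ.out ha hb) (by rw [interior_Icc]; constructor <;> linarith)

lemma uniqueDiffOn_strip (hJ : UniqueDiffOn ℝ J) : UniqueDiffOn ℝ (Icc (0 : ℝ) 1 ×ˢ J) :=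
  (uniqueDiffOn_Icc zero_lt_one).prod hJ

/-- The chain rule along a moving point, in terms of the full derivative. -/
lemma hasDerivWithinAt_comp_fderivWithin
    (hF : ContDiffOn ℝ 1 (fun p : ℝ × ℝ => F p.1 p.2) (Icc (0 : ℝ) 1 ×ˢ J))
    {D : Set ℝ} {a b : ℝ → ℝ} {a' b' r : ℝ} (ha : HasDerivWithinAt a a' D r)
    (hb : HasDerivWithinAt b b' D r) (hm : ∀ r ∈ D, a r ∈ Icc (0 : ℝ) 1 ∧ b r ∈ J) (hr : r ∈ D) :
    HasDerivWithinAt (fun r => F (a r) (b r))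
      (fderivWithin ℝ (fun p : ℝ × ℝ => F p.1 p.2) (Icc (0 : ℝ) 1 ×ˢ J) (a r, b r) (a', b')) D r := by
  have h1 : HasFDerivWithinAt (fun p : ℝ × ℝ => F p.1 p.2)
      (fderivWithin ℝ (fun p : ℝ × ℝ => F p.1 p.2) (Icc (0 : ℝ) 1 ×ˢ J) (a r, b r))
      (Icc (0 : ℝ) 1 ×ˢ J) (a r, b r) :=
    (hF.differentiableOn one_ne_zero _ ⟨(hm r hr).1, (hm r hr).2⟩).hasFDerivWithinAt
  have h2 : MapsTo (fun r => (a r, b r)) D (Icc (0 : ℝ) 1 ×ˢ J) := fun r hr => hm r hr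
  exact h1.comp_hasDerivWithinAt (f := fun r => (a r, b r)) r (ha.prodMk hb) h2

lemma spaceDeriv_eq_fderivWithin
    (hF : ContDiffOn ℝ 1 (fun p : ℝ × ℝ => F p.1 p.2) (Icc (0 : ℝ) 1 ×ˢ J))
    {x t : ℝ} (hx : x ∈ Icc (0 : ℝ) 1) (ht : t ∈ J) :
    spaceDeriv F x t
      = fderivWithin ℝ (fun p : ℝ × ℝ => F p.1 p.2) (Icc (0 : ℝ) 1 ×ˢ J) (x, t) (1, 0) :=
  (hasDerivWithinAt_comp_fderivWithin hF (hasDerivWithinAt_id x (Icc 0 1))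
    (hasDerivWithinAt_const x (Icc 0 1) t) (fun _ hr => ⟨hr, ht⟩) hx).derivWithin
    (uniqueDiffOn_Icc zero_lt_one x hx)

lemma timeDeriv_eq_fderivWithin (hJ : UniqueDiffOn ℝ J)
    (hF : ContDiffOn ℝ 1 (fun p : ℝ × ℝ => F p.1 p.2) (Icc (0 : ℝ) 1 ×ˢ J))
    {x t : ℝ} (hx : x ∈ Icc (0 : ℝ) 1) (ht : t ∈ J) :
    timeDeriv J F x t
      = fderivWithin ℝ (fun p : ℝ × ℝ => F p.1 p.2) (Icc (0 : ℝ) 1 ×ˢ J) (x, t) (0, 1) :=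
  (hasDerivWithinAt_comp_fderivWithin hF (hasDerivWithinAt_const t J x)
    (hasDerivWithinAt_id t J) (fun _ hr => ⟨hx, hr⟩) ht).derivWithin (hJ t ht)

lemma hasDerivWithinAt_spaceDeriv
    (hF : ContDiffOn ℝ 1 (fun p : ℝ × ℝ => F p.1 p.2) (Icc (0 : ℝ) 1 ×ˢ J))
    {x t : ℝ} (hx : x ∈ Icc (0 : ℝ) 1) (ht : t ∈ J) :
    HasDerivWithinAt (fun y => F y t) (spaceDeriv F x t) (Icc 0 1) x := by
  rw [spaceDeriv_eq_fderivWithin hF hx ht]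
  exact hasDerivWithinAt_comp_fderivWithin hF (hasDerivWithinAt_id x (Icc 0 1))
    (hasDerivWithinAt_const x (Icc 0 1) t) (fun _ hr => ⟨hr, ht⟩) hx

lemma hasDerivWithinAt_timeDeriv (hJ : UniqueDiffOn ℝ J)
    (hF : ContDiffOn ℝ 1 (fun p : ℝ × ℝ => F p.1 p.2) (Icc (0 : ℝ) 1 ×ˢ J))
    {x t : ℝ} (hx : x ∈ Icc (0 : ℝ) 1) (ht : t ∈ J) :
    HasDerivWithinAt (fun s => F x s) (timeDeriv J F x t) J t := by
  rw [timeDeriv_eq_fderivWithin hJ hF hx ht]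
  exact hasDerivWithinAt_comp_fderivWithin hF (hasDerivWithinAt_const t J x)
    (hasDerivWithinAt_id t J) (fun _ hr => ⟨hx, hr⟩) ht

/-- The chain rule along a moving point `(a r, r)`. -/
lemma hasDerivWithinAt_comp_moving (hJ : UniqueDiffOn ℝ J)
    (hF : ContDiffOn ℝ 1 (fun p : ℝ × ℝ => F p.1 p.2) (Icc (0 : ℝ) 1 ×ˢ J))
    {D : Set ℝ} {a : ℝ → ℝ} {a' t : ℝ} (ha : HasDerivWithinAt a a' D t)
    (hD : D ⊆ J) (hm : ∀ r ∈ D, a r ∈ Icc (0 : ℝ) 1) (ht : t ∈ D) :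
    HasDerivWithinAt (fun r => F (a r) r)
      (spaceDeriv F (a t) t * a' + timeDeriv J F (a t) t) D t := by
  refine (hasDerivWithinAt_comp_fderivWithin hF ha (hasDerivWithinAt_id t D)
    (fun r hr => ⟨hm r hr, hD hr⟩) ht).congr_deriv ?_
  rw [spaceDeriv_eq_fderivWithin hF (hm t ht) (hD ht),
    timeDeriv_eq_fderivWithin hJ hF (hm t ht) (hD ht)]
  have : ((a', 1) : ℝ × ℝ) = a' • ((1, 0) : ℝ × ℝ) + (0, 1) := by ext <;> simp
  rw [this, map_add, map_smul, smul_eq_mul, mul_comm]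
  rfl

lemma contDiffOn_spaceDeriv (hJ : UniqueDiffOn ℝ J) {n : ℕ}
    (hF : ContDiffOn ℝ (n + 1) (fun p : ℝ × ℝ => F p.1 p.2) (Icc (0 : ℝ) 1 ×ˢ J)) :
    ContDiffOn ℝ n (fun p : ℝ × ℝ => spaceDeriv F p.1 p.2) (Icc (0 : ℝ) 1 ×ˢ J) := by
  have h1 := (hF.fderivWithin (uniqueDiffOn_strip hJ) (m := n) le_rfl).clm_apply
    (contDiffOn_const (c := ((1, 0) : ℝ × ℝ)))
  refine h1.congr fun p hp => ?_
  exact spaceDeriv_eq_fderivWithin (hF.of_le (by simp)) hp.1 hp.2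

lemma contDiffOn_timeDeriv (hJ : UniqueDiffOn ℝ J) {n : ℕ}
    (hF : ContDiffOn ℝ (n + 1) (fun p : ℝ × ℝ => F p.1 p.2) (Icc (0 : ℝ) 1 ×ˢ J)) :
    ContDiffOn ℝ n (fun p : ℝ × ℝ => timeDeriv J F p.1 p.2) (Icc (0 : ℝ) 1 ×ˢ J) := by
  have h1 := (hF.fderivWithin (uniqueDiffOn_strip hJ) (m := n) le_rfl).clm_apply
    (contDiffOn_const (c := ((0, 1) : ℝ × ℝ)))
  refine h1.congr fun p hp => ?_
  exact timeDeriv_eq_fderivWithin hJ (hF.of_le (by simp)) hp.1 hp.2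

lemma exists_bound_on_strip (hJ : J.OrdConnected) (hJ0 : (0 : ℝ) ∈ J) {T : ℝ} (hT : T ∈ J)
    (hF : ContinuousOn (fun p : ℝ × ℝ => F p.1 p.2) (Icc (0 : ℝ) 1 ×ˢ J)) :
    ∃ B, 0 ≤ B ∧ ∀ x ∈ Icc (0 : ℝ) 1, ∀ t ∈ Icc 0 T, |F x t| ≤ B := by
  obtain ⟨B, hB⟩ := (isCompact_Icc.prod isCompact_Icc).exists_bound_of_continuousOn
    (hF.mono (prod_mono_right (hJ.out hJ0 hT)))
  exact ⟨max B 0, le_max_right _ _, fun x hx t ht => (hB (x, t) ⟨hx, ht⟩).trans (le_max_left _ _)⟩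

lemma continuousOn_slice
    (hF : ContinuousOn (fun p : ℝ × ℝ => F p.1 p.2) (Icc (0 : ℝ) 1 ×ˢ J)) {t : ℝ} (ht : t ∈ J) :
    ContinuousOn (fun x => F x t) (Icc 0 1) :=
  hF.comp (f := fun x => (x, t)) (by fun_prop) fun _ hx => ⟨hx, ht⟩

lemma continuousOn_time_slice
    (hF : ContinuousOn (fun p : ℝ × ℝ => F p.1 p.2) (Icc (0 : ℝ) 1 ×ˢ J)) {x : ℝ}
    (hx : x ∈ Icc (0 : ℝ) 1) : ContinuousOn (fun t => F x t) J :=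
  hF.comp (f := fun t => (x, t)) (by fun_prop) fun _ ht => ⟨hx, ht⟩

/-- Each point of `J` has a neighbourhood in `J` of the form `[0, T]`. -/
lemma exists_Icc_mem_nhdsWithin (hJ0 : IsLeast J 0) {t : ℝ} (ht : t ∈ J) :
    ∃ T ∈ J, t ≤ T ∧ Icc 0 T ∈ 𝓝[J] t := by
  by_cases h : ∃ T ∈ J, t < T
  · obtain ⟨T, hT, htT⟩ := h
    refine ⟨T, hT, htT.le, ?_⟩
    filter_upwards [self_mem_nhdsWithin, mem_nhdsWithin_of_mem_nhds (Iio_mem_nhds htT)]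
      with r hr hr'
    exact ⟨hJ0.2 hr, (mem_Iio.1 hr').le⟩
  · push Not at h
    refine ⟨t, ht, le_rfl, ?_⟩
    filter_upwards [self_mem_nhdsWithin] with r hr
    exact ⟨hJ0.2 hr, h r hr⟩

/-- Factor the difference of squares and integrate by parts in x. The time increment then falls on u
itself rather than on u_x, so the limit r → t needs no mixed derivative. -/
lemma half_integral_sq_sub
    (hu : ContDiffOn ℝ 2 (fun p : ℝ × ℝ => u p.1 p.2) (Icc (0 : ℝ) 1 ×ˢ J))
    (hJ : UniqueDiffOn ℝ J) (h0 : ∀ t ∈ J, u 0 t = 0) (h1 : ∀ t ∈ J, u 1 t = 0)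
    {t r : ℝ} (ht : t ∈ J) (hr : r ∈ J) :
    (1 / 2) * (∫ x in (0 : ℝ)..1, spaceDeriv u x r ^ 2)
      - (1 / 2) * (∫ x in (0 : ℝ)..1, spaceDeriv u x t ^ 2)
      = -(1 / 2) * ∫ x in (0 : ℝ)..1, (u x r - u x t)
          * (spaceDeriv (spaceDeriv u) x r + spaceDeriv (spaceDeriv u) x t) := by
  have hx : ContDiffOn ℝ 1 (fun p : ℝ × ℝ => spaceDeriv u p.1 p.2) (Icc (0 : ℝ) 1 ×ˢ J) :=
    contDiffOn_spaceDeriv hJ (n := 1) (hu.of_le (by norm_num))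
  have hxx : ContDiffOn ℝ 0 (fun p : ℝ × ℝ => spaceDeriv (spaceDeriv u) p.1 p.2)
      (Icc (0 : ℝ) 1 ×ˢ J) := contDiffOn_spaceDeriv hJ (n := 0) (hx.of_le (by norm_num))
  have hu1 := hu.of_le (m := 1) (by norm_num)
  have hI : ∀ {g : ℝ → ℝ}, ContinuousOn g (Icc 0 1) → IntervalIntegrable g volume 0 1 :=
    fun hg => ContinuousOn.intervalIntegrable (by rwa [uIcc_of_le zero_le_one])
  have c1 := fun t ht => continuousOn_slice (t := t) hx.continuousOn ht
  have c2 := fun t ht => continuousOn_slice (t := t) hxx.continuousOn ht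
  have key := intervalIntegral.integral_mul_deriv_eq_deriv_mul_of_hasDerivWithinAt (a := 0) (b := 1)
    (u := fun x => u x r - u x t) (v := fun x => spaceDeriv u x r + spaceDeriv u x t)
    (u' := fun x => spaceDeriv u x r - spaceDeriv u x t)
    (v' := fun x => spaceDeriv (spaceDeriv u) x r + spaceDeriv (spaceDeriv u) x t)
    (by
      rw [uIcc_of_le zero_le_one]
      exact fun x hx' => (hasDerivWithinAt_spaceDeriv hu1 hx' hr).sub
        (hasDerivWithinAt_spaceDeriv hu1 hx' ht))
    (by
      rw [uIcc_of_le zero_le_one]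
      exact fun x hx' => (hasDerivWithinAt_spaceDeriv hx hx' hr).add
        (hasDerivWithinAt_spaceDeriv hx hx' ht))
    (hI ((c1 r hr).sub (c1 t ht))) (hI ((c2 r hr).add (c2 t ht)))
  rw [key, h0 r hr, h0 t ht, h1 r hr, h1 t ht, ← mul_sub,
    ← intervalIntegral.integral_sub (f := fun x => spaceDeriv u x r ^ 2)
      (g := fun x => spaceDeriv u x t ^ 2) (hI ((c1 r hr).pow 2)) (hI ((c1 t ht).pow 2))]
  simp only [sub_self, zero_mul, zero_sub, neg_mul, mul_neg, neg_neg]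
  congr 2
  ext x
  ring

/-- The rate of change of the Dirichlet energy of a function with zero boundary values. -/
lemma hasDerivWithinAt_half_integral_sq
    (hu : ContDiffOn ℝ 2 (fun p : ℝ × ℝ => u p.1 p.2) (Icc (0 : ℝ) 1 ×ˢ J))
    (hJc : J.OrdConnected) (hJ0 : IsLeast J 0) (hJ : UniqueDiffOn ℝ J)
    (h0 : ∀ t ∈ J, u 0 t = 0) (h1 : ∀ t ∈ J, u 1 t = 0) {t : ℝ} (ht : t ∈ J) :
    HasDerivWithinAt (fun t => (1 / 2) * ∫ x in (0 : ℝ)..1, spaceDeriv u x t ^ 2)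
      (-∫ x in (0 : ℝ)..1, timeDeriv J u x t * spaceDeriv (spaceDeriv u) x t) J t := by
  have hx : ContDiffOn ℝ 1 (fun p : ℝ × ℝ => spaceDeriv u p.1 p.2) (Icc (0 : ℝ) 1 ×ˢ J) :=
    contDiffOn_spaceDeriv hJ (n := 1) (hu.of_le (by norm_num))
  have hxx := (contDiffOn_spaceDeriv hJ (n := 0) (hx.of_le (by norm_num))).continuousOn
  have hu1 := hu.of_le (m := 1) (by norm_num)
  have htt := (contDiffOn_timeDeriv hJ (n := 0) (hu.of_le (by norm_num))).continuousOn
  obtain ⟨T, hT, -, hTn⟩ := exists_Icc_mem_nhdsWithin hJ0 ht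
  obtain ⟨B, hB0, hB⟩ := exists_bound_on_strip hJc hJ0.1 hT htt
  obtain ⟨B', hB0', hB'⟩ := exists_bound_on_strip hJc hJ0.1 hT hxx
  have htT : t ∈ Icc 0 T := mem_of_mem_nhdsWithin ht hTn
  rw [hasDerivWithinAt_iff_tendsto_slope]
  have hsub : 𝓝[J \ {t}] t ≤ 𝓝[J] t := nhdsWithin_mono _ sdiff_subset
  have hIm : ∀ᶠ r in 𝓝[J \ {t}] t, r ∈ J ∧ r ∈ Icc 0 T :=
    hsub (by filter_upwards [self_mem_nhdsWithin, hTn] with r h h' using ⟨h, h'⟩)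
  have key : Tendsto (fun r => ∫ x in (0 : ℝ)..1, -(1 / 2) * (slope (fun s => u x s) t r
      * (spaceDeriv (spaceDeriv u) x r + spaceDeriv (spaceDeriv u) x t))) (𝓝[J \ {t}] t)
      (𝓝 (∫ x in (0 : ℝ)..1, -(1 / 2) * (timeDeriv J u x t *
        (spaceDeriv (spaceDeriv u) x t + spaceDeriv (spaceDeriv u) x t)))) := by
    -- The time difference quotients of u are bounded by sup |u_t| = B through the mean value
    -- inequality, and u_xx by B' at each of the two times.
    refine intervalIntegral.tendsto_integral_filter_of_dominated_convergence
      (fun _ => (1 / 2) * (B * (B' + B'))) ?_ ?_ intervalIntegrable_const ?_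
    · filter_upwards [hIm] with r hr
      have : ContinuousOn (fun x => -(1 / 2) * (slope (fun s => u x s) t r
          * (spaceDeriv (spaceDeriv u) x r + spaceDeriv (spaceDeriv u) x t))) (Icc 0 1) := by
        simp only [slope, vsub_eq_sub, smul_eq_mul]
        have a1 := continuousOn_slice hu.continuousOn hr.1
        have a2 := continuousOn_slice hu.continuousOn ht
        have a3 := continuousOn_slice hxx hr.1
        have a4 := continuousOn_slice hxx ht
        fun_prop
      rw [uIoc_of_le zero_le_one]
      exact (this.mono Ioc_subset_Icc_self).aestronglyMeasurable measurableSet_Ioc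
    · filter_upwards [hIm] with r hr
      refine ae_of_all _ fun x hx' => ?_
      rw [uIoc_of_le zero_le_one] at hx'
      replace hx' := Ioc_subset_Icc_self hx'
      have e1 : |slope (fun s => u x s) t r| ≤ B := by
        have := (convex_Icc 0 T).norm_image_sub_le_of_norm_hasDerivWithin_le
          (f := fun s => u x s) (f' := fun s => timeDeriv J u x s) (C := B) (x := t) (y := r)
          (fun s hs => (hasDerivWithinAt_timeDeriv hJ hu1 hx'
            (hJc.out hJ0.1 hT hs)).mono (hJc.out hJ0.1 hT))
          (fun s hs => hB x hx' s hs) htT hr.2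
        rw [slope_def_field, abs_div]
        exact div_le_of_le_mul₀ (abs_nonneg _) hB0 this
      have e2 := abs_add_le (spaceDeriv (spaceDeriv u) x r) (spaceDeriv (spaceDeriv u) x t)
      rw [Real.norm_eq_abs, abs_mul, abs_mul, abs_neg, abs_of_pos (one_half_pos (α := ℝ))]
      have := hB' x hx' r hr.2
      have := hB' x hx' t htT
      gcongr
      linarith
    · refine ae_of_all _ fun x hx' => ?_
      rw [uIoc_of_le zero_le_one] at hx'
      replace hx' := Ioc_subset_Icc_self hx'
      have s1 := hasDerivWithinAt_iff_tendsto_slope.1 (hasDerivWithinAt_timeDeriv hJ hu1 hx' ht)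
      have s2 : Tendsto (fun r => spaceDeriv (spaceDeriv u) x r) (𝓝[J \ {t}] t)
          (𝓝 (spaceDeriv (spaceDeriv u) x t)) :=
        (continuousOn_time_slice hxx hx' t ht).mono_left hsub
      exact (s1.mul (s2.add_const _)).const_mul _
  convert key.congr' ?_ using 2
  · rw [← intervalIntegral.integral_neg]
    congr 1
    ext x
    ring
  · filter_upwards [hIm] with r hr
    rw [slope_def_field, half_integral_sq_sub hu hJ h0 h1 ht hr.1, intervalIntegral.integral_const_mul,
      mul_div_assoc, ← intervalIntegral.integral_div]
    congr 2
    ext x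
    rw [slope_def_field]
    ring

end Regularity

/-! ### Second divided differences of W and adjacency of slopes -/

section DividedDifference

lemma hasDerivAt_deriv_of_contDiff {W : ℝ → ℝ} (hW : ContDiff ℝ 2 W) (x : ℝ) :
    HasDerivAt W (deriv W x) x ∧ HasDerivAt (deriv W) (iteratedDeriv 2 W x) x := by
  refine ⟨(hW.differentiable (by norm_num) x).hasDerivAt, ?_⟩
  have h1 : ContDiff ℝ 1 (deriv W) := by
    have := (contDiff_succ_iff_deriv (n := 1) (f := W)).1 (by rwa [one_add_one_eq_two])
    exact this.2.2
  rw [iteratedDeriv_succ, iteratedDeriv_one]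
  exact (h1.differentiable one_ne_zero x).hasDerivAt

/-- The mean value theorem for second divided differences. -/
lemma exists_iteratedDeriv_eq_of_lt {W : ℝ → ℝ} (hW : ContDiff ℝ 2 W) {a b c : ℝ} (hab : a < b)
    (hbc : b < c) : ∃ ξ ∈ Icc a c,
      (W c - W b) / (c - b) - (W b - W a) / (b - a) = iteratedDeriv 2 W ξ * ((c - a) / 2) := by
  have hba : b - a ≠ 0 := (sub_pos.2 hab).ne'
  have hcb : c - b ≠ 0 := (sub_pos.2 hbc).ne'
  have hca : c - a ≠ 0 := (sub_pos.2 (hab.trans hbc)).ne'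
  set P := (W b - W a) / (b - a) with hP
  set R := (W c - W b) / (c - b) with hR
  set M := (R - P) / (c - a) with hM
  have hPm : P * (b - a) = W b - W a := div_mul_cancel₀ _ hba
  have hRm : R * (c - b) = W c - W b := div_mul_cancel₀ _ hcb
  have hMm : M * (c - a) = R - P := div_mul_cancel₀ _ hca
  -- W minus its quadratic interpolant at a, b, c. It vanishes at all three nodes, so applying Rolle
  -- twice produces a zero of its second derivative.
  let g : ℝ → ℝ := fun x => W x - W b - P * (x - b) - M * ((x - a) * (x - b))
  let g' : ℝ → ℝ := fun x => deriv W x - P - M * (2 * x - a - b)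
  have hg : ∀ x, HasDerivAt g (g' x) x := fun x => by
    have h1 := (hasDerivAt_deriv_of_contDiff hW x).1
    have h2 := ((h1.sub_const (W b)).sub (((hasDerivAt_id x).sub_const b).const_mul P)).sub
      ((((hasDerivAt_id x).sub_const a).mul ((hasDerivAt_id x).sub_const b)).const_mul M)
    refine h2.congr_deriv ?_
    simp only [g', id]
    ring
  have hg' : ∀ x, HasDerivAt g' (iteratedDeriv 2 W x - 2 * M) x := fun x => by
    have h1 := (hasDerivAt_deriv_of_contDiff hW x).2
    have h2 := (h1.sub_const P).sub
      (((((hasDerivAt_id x).const_mul 2).sub_const a).sub_const b).const_mul M)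
    refine h2.congr_deriv ?_
    ring
  have ga : g a = 0 := by simp only [g]; linarith
  have gb : g b = 0 := by simp only [g]; ring
  have gc : g c = 0 := by
    have : M * ((c - a) * (c - b)) = (R - P) * (c - b) := by rw [← hMm]; ring
    simp only [g]
    rw [this]
    linarith
  have gcont : Continuous g := continuous_iff_continuousAt.2 fun x => (hg x).continuousAt
  have gcont' : Continuous g' := continuous_iff_continuousAt.2 fun x => (hg' x).continuousAt
  obtain ⟨y, hy, hy0⟩ := exists_hasDerivAt_eq_zero hab gcont.continuousOn (ga.trans gb.symm)
    fun x _ => hg x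
  obtain ⟨z, hz, hz0⟩ := exists_hasDerivAt_eq_zero hbc gcont.continuousOn (gb.trans gc.symm)
    fun x _ => hg x
  obtain ⟨ξ, hξ, hξ0⟩ := exists_hasDerivAt_eq_zero (hy.2.trans hz.1) gcont'.continuousOn
    (hy0.trans hz0.symm) fun x _ => hg' x
  refine ⟨ξ, ⟨(hy.1.trans hξ.1).le, (hξ.2.trans hz.2).le⟩, ?_⟩
  have : iteratedDeriv 2 W ξ = 2 * M := by linarith
  rw [this, ← hMm]
  ring

/-- The mean value theorem for the jump of the difference quotients across a face. -/
lemma exists_faceDelta_eq {W : ℝ → ℝ} (hW : ContDiff ℝ 2 W) {s : ℕ → ℝ} {i : ℕ}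
    (h : (s (i - 1) < s i ∧ s i < s (i + 1)) ∨ (s (i + 1) < s i ∧ s i < s (i - 1)) ∨
      s (i - 1) = s (i + 1)) :
    ∃ ξ, (∀ lo hi, s (i - 1) ∈ Icc lo hi → s i ∈ Icc lo hi → s (i + 1) ∈ Icc lo hi →
      ξ ∈ Icc lo hi) ∧
      faceDelta W s i = iteratedDeriv 2 W ξ * ((s (i + 1) - s (i - 1)) / 2) := by
  rcases h with ⟨h1, h2⟩ | ⟨h1, h2⟩ | h
  · obtain ⟨ξ, hξ, e⟩ := exists_iteratedDeriv_eq_of_lt hW h1 h2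
    exact ⟨ξ, fun lo hi ha _ hc => ⟨ha.1.trans hξ.1, hξ.2.trans hc.2⟩, e⟩
  · obtain ⟨ξ, hξ, e⟩ := exists_iteratedDeriv_eq_of_lt hW h1 h2
    refine ⟨ξ, fun lo hi ha _ hc => ⟨hc.1.trans hξ.1, hξ.2.trans ha.2⟩, ?_⟩
    have e1 : (W (s i) - W (s (i - 1))) / (s i - s (i - 1))
        = (W (s (i - 1)) - W (s i)) / (s (i - 1) - s i) := by
      rw [← neg_sub (W (s i)), ← neg_sub (s i), neg_div_neg_eq]
    have e2 : (W (s (i + 1)) - W (s i)) / (s (i + 1) - s i)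
        = (W (s i) - W (s (i + 1))) / (s i - s (i + 1)) := by
      rw [← neg_sub (W (s i)), ← neg_sub (s i), neg_div_neg_eq]
    rw [faceDelta, e1, e2]
    linarith
  -- At an inflection both sides vanish, so any point would do.
  · refine ⟨s i, fun _ _ _ hb _ => hb, ?_⟩
    have e1 : (W (s (i + 1)) - W (s i)) / (s (i + 1) - s i)
        = (W (s i) - W (s (i + 1))) / (s i - s (i + 1)) := by
      rw [← neg_sub (W (s i)), ← neg_sub (s i), neg_div_neg_eq]
    rw [faceDelta, h, e1]
    ring

lemma Adjacent.symm {S : Set ℝ} {a b : ℝ} (h : Adjacent S a b) : Adjacent S b a :=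
  ⟨h.2.1, h.1, h.2.2.1.symm, by simpa [min_comm, max_comm] using h.2.2.2⟩

lemma Adjacent.not_mem_of_lt {S : Set ℝ} {a b c : ℝ} (h : Adjacent S a b) (hac : a < c)
    (hcb : c < b) : c ∉ S := fun hc =>
  h.2.2.2 c hc ⟨(min_le_left _ _).trans_lt hac, hcb.trans_le (le_max_right _ _)⟩

lemma Adjacent.neg {S : Set ℝ} {a b : ℝ} (h : Adjacent S a b) :
    Adjacent {c | -c ∈ S} (-a) (-b) := by
  refine ⟨by simpa using h.1, by simpa using h.2.1, by simpa using h.2.2.1, fun c hc hh => ?_⟩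
  refine h.2.2.2 (-c) hc ?_
  rw [min_neg_neg, max_neg_neg] at hh
  exact ⟨by linarith [hh.2], by linarith [hh.1]⟩

/-- A slope between two adjacent ones is either monotone or an inflection. -/
lemma Adjacent.trichotomy {S : Set ℝ} {a b c : ℝ} (h1 : Adjacent S a b) (h2 : Adjacent S b c) :
    (a < b ∧ b < c) ∨ (c < b ∧ b < a) ∨ a = c := by
  rcases lt_or_gt_of_ne h1.2.2.1 with hab | hab <;> rcases lt_or_gt_of_ne h2.2.2.1 with hbc | hbc
  · exact .inl ⟨hab, hbc⟩
  · refine .inr (.inr ?_)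
    rcases lt_trichotomy a c with h | h | h
    · exact absurd h2.2.1 (h1.not_mem_of_lt h hbc)
    · exact h
    · exact absurd h1.1 (h2.symm.not_mem_of_lt h hab)
  · refine .inr (.inr ?_)
    rcases lt_trichotomy a c with h | h | h
    · exact absurd h1.1 (h2.not_mem_of_lt hab h)
    · exact h
    · exact absurd h2.2.1 (h1.symm.not_mem_of_lt hbc h)
  · exact .inr (.inl ⟨hbc, hab⟩)

end DividedDifference

/-! ### Behaviour of the corners at the end of an epoch -/

section CornerMotion

/-- The velocity `κ_i / l_i` of the inner faces, and `0` for the two end faces. -/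
def innerVelocity (N : ℕ) (κ y : ℕ → ℝ) (i : ℕ) : ℝ :=
  if 2 ≤ i ∧ i + 1 ≤ N then κ i / (y i - y (i - 1)) else 0

lemma faceVelocity_eq_innerVelocity (W : ℝ → ℝ) (N : ℕ) (s y : ℕ → ℝ) (i : ℕ) :
    faceVelocity W N s y i
      = innerVelocity N (fun i => Real.sqrt (1 + s i ^ 2) * faceDelta W s i) y i := by
  simp only [faceVelocity, innerVelocity, mul_div_assoc]

/-- Corners of a piecewise linear function with `N` faces of constant slopes `s` on `[α, β)`, whose
inner faces move with vertical velocity `κ_i / l_i`. -/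
structure CornerMotion (N : ℕ) (s κ : ℕ → ℝ) (x : ℝ → ℕ → ℝ) (α β : ℝ) : Prop where
  lt : α < β
  first : ∀ t ∈ Ico α β, x t 0 = 0
  last : ∀ t ∈ Ico α β, x t N = 1
  strict : ∀ t ∈ Ico α β, ∀ i, i < N → x t i < x t (i + 1)
  slope_ne : ∀ i, 1 ≤ i → i < N → s i ≠ s (i + 1)
  deriv : ∀ t ∈ Ico α β, ∀ i, 1 ≤ i → i < N → HasDerivWithinAt (fun r => x r i)
    (-(innerVelocity N κ (x t) (i + 1) - innerVelocity N κ (x t) i) / (s (i + 1) - s i))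
    (Ico α β) t

lemma corner_mono {N : ℕ} {y : ℕ → ℝ} (h : ∀ i, i < N → y i ≤ y (i + 1)) {i j : ℕ} (hij : i ≤ j)
    (hj : j ≤ N) : y i ≤ y j := by
  induction j, hij using Nat.le_induction with
  | base => exact le_rfl
  | succ j _ ih => exact (ih (by omega)).trans (h j (by omega))

lemma exists_tendsto_of_deriv_nonneg {f f' : ℝ → ℝ} {α β B : ℝ} (h : α < β)
    (hf : ∀ t ∈ Ico α β, HasDerivWithinAt f (f' t) (Ico α β) t) (h0 : ∀ t ∈ Ico α β, 0 ≤ f' t)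
    (hB : ∀ t ∈ Ico α β, f t ≤ B) : ∃ l, Tendsto f (𝓝[<] β) (𝓝 l) := by
  have hd : ∀ t ∈ Ioo α β, HasDerivAt f (f' t) t := fun t ht =>
    (hf t (Ioo_subset_Ico_self ht)).hasDerivAt (Ico_mem_nhds ht.1 ht.2)
  have hm : MonotoneOn f (Ioo α β) := by
    refine monotoneOn_of_deriv_nonneg (convex_Ioo α β)
      (fun t ht => (hd t ht).continuousAt.continuousWithinAt) ?_ ?_
    · rw [interior_Ioo]
      exact fun t ht => (hd t ht).differentiableAt.differentiableWithinAt
    · rw [interior_Ioo]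
      exact fun t ht => (hd t ht).deriv ▸ h0 t (Ioo_subset_Ico_self ht)
  refine ⟨_, hm.tendsto_nhdsWithin_Ioo_left (nonempty_Ioo.2 h) ⟨B, ?_⟩⟩
  rintro _ ⟨t, ht, rfl⟩
  exact hB t (Ioo_subset_Ico_self ht)

namespace CornerMotion

variable {N : ℕ} {s κ : ℕ → ℝ} {x : ℝ → ℕ → ℝ} {α β : ℝ}

lemma mem_Icc (h : CornerMotion N s κ x α β) {t : ℝ} (ht : t ∈ Ico α β) {i : ℕ} (hi : i ≤ N) :
    x t i ∈ Icc (0 : ℝ) 1 := by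
  have hm := fun i hi => (h.strict t ht i hi).le
  exact ⟨h.first t ht ▸ corner_mono hm (Nat.zero_le i) hi, h.last t ht ▸ corner_mono hm hi le_rfl⟩

/-- The intercept of the line carrying the `i`-th face moves with the velocity of that face. -/
lemma hasDerivWithinAt_intercept (h : CornerMotion N s κ x α β) {t : ℝ} (ht : t ∈ Ico α β) {i : ℕ}
    (hi : 1 ≤ i) (hiN : i ≤ N) :
    HasDerivWithinAt (fun r => ∑ j ∈ Finset.Ico 1 i, (s j - s (j + 1)) * x r j)
      (innerVelocity N κ (x t) i) (Ico α β) t := by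
  induction i, hi using Nat.le_induction with
  | base =>
    have : innerVelocity N κ (x t) 1 = 0 := by simp [innerVelocity]
    simpa [this] using hasDerivWithinAt_const t (Ico α β) (0 : ℝ)
  | succ i hi ih =>
    simp only [Finset.sum_Ico_succ_top hi]
    refine ((ih (by omega)).add ((h.deriv t ht i hi (by omega)).const_mul (s i - s (i + 1)))
      ).congr_deriv ?_
    have := sub_ne_zero.2 (h.slope_ne i hi (by omega)).symm
    field_simp
    ring

/-- The velocity κ_i / l_i keeps the sign of κ_i, so the intercept is monotone; it is bounded
because the corners stay in [0,1]. No bound on the velocity itself is available, since faces may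
shrink. -/
lemma exists_tendsto_intercept (h : CornerMotion N s κ x α β) {i : ℕ}
    (hi : 1 ≤ i) (hiN : i ≤ N) :
    ∃ l, Tendsto (fun r => ∑ j ∈ Finset.Ico 1 i, (s j - s (j + 1)) * x r j) (𝓝[<] β) (𝓝 l) := by
  have hb : ∀ t ∈ Ico α β, |∑ j ∈ Finset.Ico 1 i, (s j - s (j + 1)) * x t j|
      ≤ ∑ j ∈ Finset.Ico 1 i, |s j - s (j + 1)| := fun t ht => by
    refine (Finset.abs_sum_le_sum_abs _ _).trans (Finset.sum_le_sum fun j hj => ?_)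
    have hx := h.mem_Icc ht (i := j) (by have := Finset.mem_Ico.1 hj; omega)
    rw [abs_mul, abs_of_nonneg hx.1]
    exact mul_le_of_le_one_right (abs_nonneg _) hx.2
  have hl : ∀ t ∈ Ico α β, 2 ≤ i ∧ i + 1 ≤ N → 0 < x t i - x t (i - 1) := fun t ht h2 => by
    have := h.strict t ht (i - 1) (by omega)
    rw [Nat.sub_add_cancel hi] at this
    linarith
  rcases le_total 0 (κ i) with hκ | hκ
  · refine exists_tendsto_of_deriv_nonneg h.lt
      (fun t ht => h.hasDerivWithinAt_intercept ht hi hiN) (fun t ht => ?_)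
      (fun t ht => (le_abs_self _).trans (hb t ht))
    unfold innerVelocity
    split_ifs with h2
    · exact div_nonneg hκ (hl t ht h2).le
    · exact le_rfl
  · have h0 : ∀ t ∈ Ico α β, 0 ≤ -innerVelocity N κ (x t) i := fun t ht => by
      unfold innerVelocity
      split_ifs with h2
      · exact neg_nonneg.2 (div_nonpos_of_nonpos_of_nonneg hκ (hl t ht h2).le)
      · simp
    obtain ⟨l, hl⟩ := exists_tendsto_of_deriv_nonneg h.lt
      (fun t ht => (h.hasDerivWithinAt_intercept ht hi hiN).neg) h0
      (fun t ht => (neg_le_abs _).trans (hb t ht))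
    exact ⟨-l, by simpa using hl.neg⟩

/-- The corners converge at the end of the motion. -/
lemma exists_tendsto (h : CornerMotion N s κ x α β) :
    ∃ X : ℕ → ℝ, ∀ i, i ≤ N → Tendsto (fun t => x t i) (𝓝[<] β) (𝓝 (X i)) := by
  have key : ∀ i, ∃ l, i ≤ N → Tendsto (fun t => x t i) (𝓝[<] β) (𝓝 l) := by
    intro i
    by_cases hi : i ≤ N
    swap
    · exact ⟨0, fun h => absurd h hi⟩
    have hev : ∀ᶠ t in 𝓝[<] β, t ∈ Ico α β :=
      Filter.mem_of_superset (Ioo_mem_nhdsLT h.lt) Ioo_subset_Ico_self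
    rcases Nat.eq_zero_or_pos i with rfl | hi0
    · exact ⟨0, fun _ => tendsto_const_nhds.congr'
        (hev.mono fun t ht => (h.first t ht).symm)⟩
    rcases hi.eq_or_lt with rfl | hiN
    · exact ⟨1, fun _ => tendsto_const_nhds.congr'
        (hev.mono fun t ht => (h.last t ht).symm)⟩
    obtain ⟨l, hl⟩ := h.exists_tendsto_intercept hi0 hi
    obtain ⟨l', hl'⟩ := h.exists_tendsto_intercept (i := i + 1) (by omega) hiN
    -- A corner is recovered from the intercepts of the two lines that meet there.
    refine ⟨(l' - l) / (s i - s (i + 1)), fun _ => ?_⟩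
    refine ((hl'.sub hl).div_const (s i - s (i + 1))).congr fun t => ?_
    rw [Finset.sum_Ico_succ_top hi0, add_sub_cancel_left,
      mul_div_cancel_left₀ _ (sub_ne_zero.2 (h.slope_ne i hi0 hiN))]
  choose X hX using key
  exact ⟨X, hX⟩

lemma neg (h : CornerMotion N s κ x α β) :
    CornerMotion N (fun i => -s i) (fun i => -κ i) x α β where
  lt := h.lt
  first := h.first
  last := h.last
  strict := h.strict
  slope_ne i hi hiN := by simpa using h.slope_ne i hi hiN
  deriv t ht i hi hiN := by
    have e : ∀ i, innerVelocity N (fun i => -κ i) (x t) i = -innerVelocity N κ (x t) i := by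
      intro i
      unfold innerVelocity
      split_ifs <;> simp [neg_div]
    refine (h.deriv t ht i hi hiN).congr_deriv ?_
    rw [e, e, ← neg_div_neg_eq]
    congr 1 <;> ring

variable {X : ℕ → ℝ} {S : Set ℝ}

lemma limit_mono (h : CornerMotion N s κ x α β)
    (hX : ∀ i, i ≤ N → Tendsto (fun t => x t i) (𝓝[<] β) (𝓝 (X i))) {i : ℕ} (hi : i < N) :
    X i ≤ X (i + 1) := by
  refine le_of_tendsto_of_tendsto (hX i hi.le) (hX (i + 1) hi) ?_
  filter_upwards [Ioo_mem_nhdsLT h.lt] with t ht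
  exact (h.strict t (Ioo_subset_Ico_self ht) i hi).le

/-- Between slopes `s j < c < s k` with no slope jumping over `c`, some face between has slope `c`
and is convex. -/
lemma exists_convex_face {j k : ℕ} {c : ℝ} (hjk : j < k) (hj : s j < c) (hk : c < s k)
    (hne : ∀ i, j ≤ i → i < k → s i ≠ s (i + 1))
    (hc : ∀ i, j ≤ i → i < k → s i < c → ¬ c < s (i + 1)) :
    ∃ i, j < i ∧ i < k ∧ s (i - 1) < s i ∧ s i < s (i + 1) := by
  classical
  have hex : ∃ p, j ≤ p ∧ p ≤ k ∧ c < s p := ⟨k, hjk.le, le_rfl, hk⟩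
  obtain ⟨hp1, hp2, hp3⟩ := Nat.find_spec hex
  -- The first slope above c. Its predecessor is not above c and cannot lie below it, as no step
  -- jumps over c; so it has slope exactly c, and it is the required face.
  set p := Nat.find hex with hp
  have hmin : ∀ q, j ≤ q → q < p → s q ≤ c := fun q hq hqp => by
    by_contra hh
    exact Nat.find_min hex hqp ⟨hq, by omega, not_le.1 hh⟩
  have hpj : j < p := lt_of_le_of_ne hp1 fun e => by rw [← e] at hp3; linarith
  have e1 : s (p - 1) = c := by
    refine le_antisymm (hmin _ (by omega) (by omega)) (not_lt.1 fun hlt => ?_)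
    refine hc (p - 1) (by omega) (by omega) hlt ?_
    rwa [Nat.sub_add_cancel (by omega)]
  have hpj' : j < p - 1 := lt_of_le_of_ne (by omega) fun e => by rw [← e] at e1; linarith
  refine ⟨p - 1, hpj', by omega, ?_, ?_⟩
  · refine lt_of_le_of_ne (e1 ▸ hmin _ (by omega) (by omega)) ?_
    have := hne (p - 1 - 1) (by omega) (by omega)
    rwa [Nat.sub_add_cancel (by omega)] at this
  · rw [Nat.sub_add_cancel (by omega), e1]
    exact hp3

lemma tendsto_innerVelocity_atTop (h : CornerMotion N s κ x α β)
    (hX : ∀ i, i ≤ N → Tendsto (fun t => x t i) (𝓝[<] β) (𝓝 (X i))) {i : ℕ}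
    (hi : 2 ≤ i) (hiN : i + 1 ≤ N) (hκ : 0 < κ i) (he : X (i - 1) = X i) :
    Tendsto (fun t => innerVelocity N κ (x t) i) (𝓝[<] β) atTop := by
  simp only [innerVelocity, hi, hiN, and_self, if_true]
  have h1 : Tendsto (fun t => x t i - x t (i - 1)) (𝓝[<] β) (𝓝[>] 0) := by
    refine tendsto_nhdsWithin_iff.2 ⟨?_, ?_⟩
    · have := (hX i (by omega)).sub (hX (i - 1) (by omega))
      rwa [he, sub_self] at this
    · filter_upwards [Ioo_mem_nhdsLT h.lt] with t ht
      have := h.strict t (Ioo_subset_Ico_self ht) (i - 1) (by omega)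
      rw [Nat.sub_add_cancel (by omega)] at this
      exact sub_pos.2 this
  simp only [div_eq_mul_inv]
  exact (tendsto_inv_nhdsGT_zero.comp h1).const_mul_atTop hκ

/-- A group of faces between two faces of slopes `s j < s k` cannot collapse to a point if it
contains a convex face: the nearest faces of bounded velocity would move apart. -/
lemma not_collapse (h : CornerMotion N s κ x α β)
    (hX : ∀ i, i ≤ N → Tendsto (fun t => x t i) (𝓝[<] β) (𝓝 (X i)))
    (hadj : ∀ i, 1 ≤ i → i < N → Adjacent S (s i) (s (i + 1)))
    (hpos : ∀ i, 2 ≤ i → i + 1 ≤ N → s (i - 1) < s i → s i < s (i + 1) → 0 < κ i)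
    (hzero : ∀ i, 2 ≤ i → i + 1 ≤ N → s (i - 1) = s (i + 1) → κ i = 0)
    {j k : ℕ} (hj : 1 ≤ j) (hk : k ≤ N) (hXj : X (j - 1) < X j)
    (hXk : X (k - 1) < X k) (hc : X j = X (k - 1))
    (hex : ∃ i, j < i ∧ i < k ∧ s (i - 1) < s i ∧ s i < s (i + 1)) : False := by
  classical
  have hmono := fun i hi => h.limit_mono hX (i := i) hi
  have hcol : ∀ i, j ≤ i → i < k → X i = X j := fun i h1 h2 =>
    le_antisymm (hc ▸ corner_mono hmono (show i ≤ k - 1 by omega) (by omega))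
      (corner_mono hmono h1 (by omega))
  -- faces that do not collapse and inflection faces have velocities with finite limits
  have hend : ∀ i, 1 ≤ i → i ≤ N → X (i - 1) < X i →
      ∃ l, Tendsto (fun t => innerVelocity N κ (x t) i) (𝓝[<] β) (𝓝 l) := fun i hi hiN hlt => by
    by_cases h2 : 2 ≤ i ∧ i + 1 ≤ N
    · simp only [innerVelocity, h2, and_self, if_true]
      exact ⟨_, tendsto_const_nhds.div ((hX i hiN).sub (hX (i - 1) (by omega)))
        (sub_pos.2 hlt).ne'⟩
    · simp only [innerVelocity, h2, if_false]
      exact ⟨0, tendsto_const_nhds⟩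
  have hinf : ∀ i, 2 ≤ i → i + 1 ≤ N → s (i - 1) = s (i + 1) →
      ∃ l, Tendsto (fun t => innerVelocity N κ (x t) i) (𝓝[<] β) (𝓝 l) := fun i hi hiN he => by
    simp only [innerVelocity, hi, hiN, and_self, if_true, hzero i hi hiN he, zero_div]
    exact ⟨0, tendsto_const_nhds⟩
  have htri : ∀ i, 2 ≤ i → i + 1 ≤ N → (s (i - 1) < s i ∧ s i < s (i + 1)) ∨
      (s (i + 1) < s i ∧ s i < s (i - 1)) ∨ s (i - 1) = s (i + 1) := fun i hi hiN => by
    have := hadj (i - 1) (by omega) (by omega)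
    rw [Nat.sub_add_cancel (by omega)] at this
    exact this.trichotomy (hadj i (by omega) (by omega))
  -- Let p be the first convex face of the group and q the last. The second is found by minimising
  -- the distance d = k - q.
  obtain ⟨⟨hp1, hp2, hp3, hp4⟩, hmin⟩ := (⟨Nat.find_spec hex, fun q hq => Nat.find_min hex hq⟩ :
    _ ∧ ∀ q < Nat.find hex, _)
  set p := Nat.find hex with hp
  have hex' : ∃ d, d ≤ k ∧ j < k - d ∧ k - d < k ∧ s (k - d - 1) < s (k - d) ∧
      s (k - d) < s (k - d + 1) :=
    ⟨k - p, by omega, by rwa [Nat.sub_sub_self hp2.le], by omega,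
      by rwa [Nat.sub_sub_self hp2.le], by rwa [Nat.sub_sub_self hp2.le]⟩
  obtain ⟨⟨hq0, hq1, hq2, hq3, hq4⟩, hmax⟩ :=
    (⟨Nat.find_spec hex', fun q hq => Nat.find_min hex' hq⟩ : _ ∧ ∀ q < Nat.find hex', _)
  set d := Nat.find hex' with hd
  obtain ⟨q, hq⟩ : ∃ q, q = k - d := ⟨_, rfl⟩
  rw [← hq] at hq1 hq2 hq3 hq4
  have hpq : p ≤ q := not_lt.1 fun hlt => hmin q hlt ⟨hq1, hq2, hq3, hq4⟩
  -- velocities of the two bounding faces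
  obtain ⟨lp, hlp⟩ : ∃ l, Tendsto (fun t => innerVelocity N κ (x t) (p - 1)) (𝓝[<] β) (𝓝 l) := by
    rcases (show p - 1 = j ∨ j < p - 1 by omega) with e | hlt
    · rw [e]
      exact hend j hj (by omega) hXj
    -- Inside the group, face p - 1 is not convex by minimality of p, and not concave because the
    -- slope rises from it to p. It is therefore an inflection, with zero velocity.
    · have hne : ¬ (s (p - 1 - 1) < s (p - 1)) := fun hh => hmin (p - 1) (by omega)
        ⟨hlt, by omega, hh, by rwa [Nat.sub_add_cancel (by omega)]⟩
      have := htri (p - 1) (by omega) (by omega)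
      rw [Nat.sub_add_cancel (by omega)] at this
      refine hinf (p - 1) (by omega) (by omega) ?_
      rw [Nat.sub_add_cancel (by omega)]
      rcases this with h1 | h1 | h1
      · exact absurd h1.1 hne
      · exact absurd (hp3.trans h1.1) (lt_irrefl _)
      · exact h1
  obtain ⟨lq, hlq⟩ : ∃ l, Tendsto (fun t => innerVelocity N κ (x t) (q + 1)) (𝓝[<] β) (𝓝 l) := by
    rcases (show q + 1 = k ∨ q + 1 < k by omega) with e | hlt
    · rw [e]
      exact hend k (by omega) hk hXk
    · have hne : ¬ (s (q + 1) < s (q + 1 + 1)) := fun hh => by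
        refine hmax (k - (q + 1)) (by omega) ?_
        rw [Nat.sub_sub_self hlt.le]
        exact ⟨by omega, by omega, hlt, by simpa using hq4, hh⟩
      have := htri (q + 1) (by omega) (by omega)
      rw [Nat.add_sub_cancel] at this
      refine hinf (q + 1) (by omega) (by omega) ?_
      rw [Nat.add_sub_cancel]
      rcases this with h1 | h1 | h1
      · exact absurd h1.2 hne
      · exact absurd (hq4.trans h1.2) (lt_irrefl _)
      · exact h1
  have htop : ∀ i, j < i → i < k → s (i - 1) < s i → s i < s (i + 1) →
      Tendsto (fun t => innerVelocity N κ (x t) i) (𝓝[<] β) atTop := fun i h1 h2 h3 h4 =>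
    h.tendsto_innerVelocity_atTop hX (by omega) (by omega)
      (hpos i (by omega) (by omega) h3 h4)
      ((hcol (i - 1) (by omega) (by omega)).trans (hcol i (by omega) h2).symm)
  -- the distance between the outer corners has a positive derivative near `β`
  have hsp : 0 < s p - s (p - 1) := sub_pos.2 hp3
  have hsq : 0 < s (q + 1) - s q := sub_pos.2 hq4
  have hderiv : ∀ t ∈ Ico α β, HasDerivWithinAt (fun r => x r q - x r (p - 1))
      ((innerVelocity N κ (x t) q - innerVelocity N κ (x t) (q + 1)) / (s (q + 1) - s q)
        + (innerVelocity N κ (x t) p - innerVelocity N κ (x t) (p - 1)) / (s p - s (p - 1)))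
      (Ico α β) t := fun t ht => by
    have h1 := h.deriv t ht q (by omega) (by omega)
    have h2 := h.deriv t ht (p - 1) (by omega) (by omega)
    rw [Nat.sub_add_cancel (by omega)] at h2
    refine (h1.sub h2).congr_deriv ?_
    rw [neg_div, neg_div, sub_neg_eq_add, ← neg_div, neg_sub]
  have hlim : Tendsto (fun t =>
      (innerVelocity N κ (x t) q - innerVelocity N κ (x t) (q + 1)) / (s (q + 1) - s q)
        + (innerVelocity N κ (x t) p - innerVelocity N κ (x t) (p - 1)) / (s p - s (p - 1)))
      (𝓝[<] β) atTop := by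
    refine Tendsto.atTop_add_atTop ?_ ?_
    · refine Tendsto.atTop_div_const hsq ?_
      simp only [sub_eq_add_neg]
      exact tendsto_atTop_add_right_of_le' _ (-(lq + 1)) (htop q hq1 hq2 hq3 hq4)
        ((hlq.eventually_lt_const (lt_add_one lq)).mono fun t ht => by linarith)
    · refine Tendsto.atTop_div_const hsp ?_
      simp only [sub_eq_add_neg]
      exact tendsto_atTop_add_right_of_le' _ (-(lp + 1)) (htop p hp1 hp2 hp3 hp4)
        ((hlp.eventually_lt_const (lt_add_one lp)).mono fun t ht => by linarith)
  obtain ⟨γ, hγ, hγd⟩ := (mem_nhdsLT_iff_exists_Ioo_subset' h.lt).1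
    ((hlim.eventually_gt_atTop 0).and (Ioo_mem_nhdsLT h.lt))
  have hd' : ∀ t ∈ Ioo γ β, HasDerivAt (fun r => x r q - x r (p - 1)) _ t := fun t ht =>
    (hderiv t (Ioo_subset_Ico_self (hγd ht).2)).hasDerivAt
      (Ico_mem_nhds (hγd ht).2.1 (hγd ht).2.2)
  have hsm : StrictMonoOn (fun r => x r q - x r (p - 1)) (Ioo γ β) := by
    refine strictMonoOn_of_deriv_pos (convex_Ioo γ β)
      (fun t ht => (hd' t ht).continuousAt.continuousWithinAt) ?_
    rw [interior_Ioo]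
    exact fun t ht => (hd' t ht).deriv ▸ (hγd ht).1
  obtain ⟨t₁, ht₁⟩ := nonempty_Ioo.2 (show γ < β from hγ)
  -- The width of faces p through q is positive and strictly increasing near β, yet tends to 0.
  have hl0 : Tendsto (fun r => x r q - x r (p - 1)) (𝓝[<] β) (𝓝 0) := by
    have := (hX q (by omega)).sub (hX (p - 1) (by omega))
    rwa [hcol q (by omega) hq2, hcol (p - 1) (by omega) (by omega), sub_self] at this
  have hge : x t₁ q - x t₁ (p - 1) ≤ 0 := by
    refine ge_of_tendsto hl0 ?_
    filter_upwards [Ioo_mem_nhdsLT ht₁.2] with t ht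
    exact hsm.monotoneOn ht₁ ⟨ht₁.1.trans ht.1, ht.2⟩ ht.1.le
  have hIco := Ioo_subset_Ico_self (hγd ht₁).2
  have h1 := h.strict t₁ hIco (p - 1) (by omega)
  rw [Nat.sub_add_cancel (by omega)] at h1
  have h2 := corner_mono (fun i hi => (h.strict t₁ hIco i hi).le) hpq (by omega)
  linarith

/-- The slopes on the two sides of a point where faces have collapsed are adjacent. -/
lemma adjacent_of_collapse (h : CornerMotion N s κ x α β)
    (hX : ∀ i, i ≤ N → Tendsto (fun t => x t i) (𝓝[<] β) (𝓝 (X i)))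
    (hadj : ∀ i, 1 ≤ i → i < N → Adjacent S (s i) (s (i + 1)))
    (hpos : ∀ i, 2 ≤ i → i + 1 ≤ N → s (i - 1) < s i → s i < s (i + 1) → 0 < κ i)
    (hneg : ∀ i, 2 ≤ i → i + 1 ≤ N → s (i + 1) < s i → s i < s (i - 1) → κ i < 0)
    (hzero : ∀ i, 2 ≤ i → i + 1 ≤ N → s (i - 1) = s (i + 1) → κ i = 0)
    {j k : ℕ} (hj : 1 ≤ j) (hjk : j < k) (hk : k ≤ N) (hXj : X (j - 1) < X j)
    (hXk : X (k - 1) < X k) (hc : X j = X (k - 1)) (hne : s j ≠ s k) : Adjacent S (s j) (s k) := by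
  have hmem : ∀ i, 1 ≤ i → i ≤ N → 1 < N → s i ∈ S := fun i hi hiN hN => by
    rcases hiN.lt_or_eq with hlt | e
    · exact (hadj i hi hlt).1
    · have := (hadj (i - 1) (by omega) (by omega)).2.1
      rwa [Nat.sub_add_cancel hi] at this
  refine ⟨hmem j hj (by omega) (by omega), hmem k (by omega) hk (by omega), hne,
    fun c hcS hcb => ?_⟩
  rcases lt_or_gt_of_ne hne with hlt | hlt
  · rw [min_eq_left hlt.le, max_eq_right hlt.le] at hcb
    exact h.not_collapse hX hadj hpos hzero hj hk hXj hXk hc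
      (exists_convex_face hjk hcb.1 hcb.2 (fun i h1 h2 => h.slope_ne i (by omega) (by omega))
        fun i h1 h2 h3 h4 => (hadj i (by omega) (by omega)).not_mem_of_lt h3 h4 hcS)
  · rw [min_eq_right hlt.le, max_eq_left hlt.le] at hcb
    -- For decreasing slopes, reflect the graph: concave faces become convex and the corners are
    -- unchanged.
    refine h.neg.not_collapse hX (S := {c | -c ∈ S})
      (fun i h1 h2 => (hadj i h1 h2).neg)
      (fun i h1 h2 h3 h4 => neg_pos.2 (hneg i h1 h2 (neg_lt_neg_iff.1 h4) (neg_lt_neg_iff.1 h3)))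
      (fun i h1 h2 h3 => neg_eq_zero.2 (hzero i h1 h2 (neg_injective h3))) hj hk hXj hXk hc
      (exists_convex_face (c := -c) hjk (neg_lt_neg hcb.2) (neg_lt_neg hcb.1)
        (fun i h1 h2 => h.neg.slope_ne i (by omega) (by omega)) fun i h1 h2 h3 h4 => ?_)
    exact (hadj i (by omega) (by omega)).symm.not_mem_of_lt (neg_lt_neg_iff.1 h4)
      (neg_lt_neg_iff.1 h3) hcS

end CornerMotion
end CornerMotion

/-! ### Piecewise linear functions, their limits, and control of the slopes -/

section Faces

variable {S : Set ℝ} {f : ℝ → ℝ} {N : ℕ} {s x : ℕ → ℝ}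

lemma exists_mem_Ioc_of_mem_Ioc {X : ℕ → ℝ} {y : ℝ} (h0 : X 0 < y) (hN : y ≤ X N) :
    ∃ i, i < N ∧ X i < y ∧ y ≤ X (i + 1) := by
  classical
  have hex : ∃ i, y ≤ X i := ⟨N, hN⟩
  have hpos : Nat.find hex ≠ 0 := fun e => by
    have := Nat.find_spec hex
    rw [e] at this
    linarith
  have hle : Nat.find hex ≤ N := Nat.find_min' hex hN
  refine ⟨Nat.find hex - 1, by omega, not_le.1 (Nat.find_min hex (by omega)), ?_⟩
  rw [Nat.sub_add_cancel (by omega)]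
  exact Nat.find_spec hex

namespace HasFaces

lemma mono (h : HasFaces S f N s x) {i j : ℕ} (hij : i ≤ j) (hj : j ≤ N) : x i ≤ x j :=
  corner_mono (fun i hi => (h.strict i hi).le) hij hj

lemma mem_Icc (h : HasFaces S f N s x) {i : ℕ} (hi : i ≤ N) : x i ∈ Icc (0 : ℝ) 1 :=
  ⟨h.first ▸ h.mono (Nat.zero_le i) hi, h.last ▸ h.mono hi le_rfl⟩

lemma sub_eq (h : HasFaces S f N s x) {i : ℕ} (hi : i < N) {y y' : ℝ}
    (hy : y ∈ Icc (x i) (x (i + 1))) (hy' : y' ∈ Icc (x i) (x (i + 1))) :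
    f y - f y' = s (i + 1) * (y - y') := by
  rw [h.linear i hi y hy, h.linear i hi y' hy']
  ring

lemma hasDerivAt (h : HasFaces S f N s x) {i : ℕ} (hi : i < N) {y : ℝ}
    (hy : y ∈ Ioo (x i) (x (i + 1))) : HasDerivAt f (s (i + 1)) y := by
  have h1 : HasDerivAt (fun y => f (x i) + s (i + 1) * (y - x i)) (s (i + 1)) y := by
    simpa using (((hasDerivAt_id y).sub_const (x i)).const_mul (s (i + 1))).const_add (f (x i))
  refine h1.congr_of_eventuallyEq ?_
  filter_upwards [Icc_mem_nhds hy.1 hy.2] with z hz using h.linear i hi z hz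

lemma derivWithin_eq (h : HasFaces S f N s x) {i : ℕ} (hi : i < N) {y : ℝ}
    (hy : y ∈ Ioo (x i) (x (i + 1))) : derivWithin f (Icc 0 1) y = s (i + 1) := by
  refine (h.hasDerivAt hi hy).hasDerivWithinAt.derivWithin (uniqueDiffOn_Icc zero_lt_one y ?_)
  exact ⟨(h.mem_Icc hi.le).1.trans hy.1.le, hy.2.le.trans (h.mem_Icc hi).2⟩

lemma slope_eq_zero_of_one (h : HasFaces S f 1 s x) (h0 : f 0 = 0) (h1 : f 1 = 0) : s 1 = 0 := by
  have := h.linear 0 one_pos 1 (by rw [h.first, zero_add, h.last]; simp)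
  rw [h.first, h0, h1] at this
  simpa using this.symm

end HasFaces

lemma slope_unique {σ σ' lo hi : ℝ} (hlt : lo < hi)
    (h : ∀ y ∈ Ioo lo hi, ∀ y' ∈ Ioo lo hi, f y - f y' = σ * (y - y'))
    (h' : ∀ y ∈ Ioo lo hi, ∀ y' ∈ Ioo lo hi, f y - f y' = σ' * (y - y')) : σ = σ' := by
  obtain ⟨a, ha⟩ := nonempty_Ioo.2 hlt
  obtain ⟨b, hb⟩ := nonempty_Ioo.2 ha.2
  have hb' : b ∈ Ioo lo hi := ⟨ha.1.trans hb.1, hb.2⟩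
  have := (h b hb' a ha).symm.trans (h' b hb' a ha)
  exact mul_right_cancel₀ (sub_pos.2 hb.1).ne' this

/-- A corner of the limit of piecewise linear functions, whose corners converge to `X`, is a limit
of two nearest non-collapsing faces with the same slopes as the limit. -/
lemma exists_collapsed {X : ℕ → ℝ} {N' : ℕ} {s' x' : ℕ → ℝ} (hX0 : X 0 = 0) (hXN : X N = 1)
    (hmono : ∀ i, i < N → X i ≤ X (i + 1))
    (hlin : ∀ i, i < N → ∀ y ∈ Ioo (X i) (X (i + 1)), ∀ y' ∈ Ioo (X i) (X (i + 1)),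
      f y - f y' = s (i + 1) * (y - y'))
    (hf : HasFaces S f N' s' x') {p : ℕ} (hp : 1 ≤ p) (hpN : p < N') :
    ∃ j k, 1 ≤ j ∧ j < k ∧ k ≤ N ∧ X (j - 1) < X j ∧ X (k - 1) < X k ∧ X j = X (k - 1) ∧
      s j = s' p ∧ s k = s' (p + 1) := by
  classical
  have hl := hf.strict (p - 1) (by omega)
  rw [Nat.sub_add_cancel hp] at hl
  have hr := hf.strict p hpN
  have hpos : X 0 < x' p := hX0.symm ▸ (hf.mem_Icc (i := p - 1) (by omega)).1.trans_lt hl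
  have hlt1 : x' p < X N := hXN.symm ▸ hr.trans_le (hf.mem_Icc (i := p + 1) hpN).2
  have hleft : ∀ y ∈ Icc (x' (p - 1)) (x' p), ∀ y' ∈ Icc (x' (p - 1)) (x' p),
      f y - f y' = s' p * (y - y') := fun y hy y' hy' => by
    have := hf.sub_eq (i := p - 1) (by omega) (y := y) (y' := y')
    rw [Nat.sub_add_cancel hp] at this
    exact this hy hy'
  have hright := fun y hy y' hy' => hf.sub_eq (i := p) hpN (y := y) (y' := y') hy hy'
  have hsl : ∀ i, i < N → X i < x' p → x' p ≤ X (i + 1) → s (i + 1) = s' p := fun i hi h1 h2 =>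
    slope_unique (lo := max (X i) (x' (p - 1))) (hi := x' p) (max_lt h1 hl)
      (fun y hy y' hy' => hlin i hi y ⟨(le_max_left _ _).trans_lt hy.1, hy.2.trans_le h2⟩ y'
        ⟨(le_max_left _ _).trans_lt hy'.1, hy'.2.trans_le h2⟩)
      fun y hy y' hy' => hleft y ⟨(le_max_right _ _).trans hy.1.le, hy.2.le⟩ y'
        ⟨(le_max_right _ _).trans hy'.1.le, hy'.2.le⟩
  have hsr : ∀ i, i < N → X i ≤ x' p → x' p < X (i + 1) → s (i + 1) = s' (p + 1) :=
    fun i hi h1 h2 =>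
    slope_unique (lo := x' p) (hi := min (X (i + 1)) (x' (p + 1))) (lt_min h2 hr)
      (fun y hy y' hy' => hlin i hi y ⟨h1.trans_lt hy.1, hy.2.trans_le (min_le_left _ _)⟩ y'
        ⟨h1.trans_lt hy'.1, hy'.2.trans_le (min_le_left _ _)⟩)
      fun y hy y' hy' => hright y ⟨hy.1.le, hy.2.le.trans (min_le_right _ _)⟩ y'
        ⟨hy'.1.le, hy'.2.le.trans (min_le_right _ _)⟩
  obtain ⟨i, hi, hi1, hi2⟩ := exists_mem_Ioc_of_mem_Ioc hpos hlt1.le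
  -- Otherwise the corner would lie inside a single limiting face, which would have both of the
  -- distinct slopes.
  have hie : X (i + 1) = x' p := by
    refine le_antisymm (not_lt.1 fun hgt => ?_) hi2
    exact hf.slope_ne p hp hpN ((hsl i hi hi1 hi2).symm.trans (hsr i hi hi1.le hgt))
  have hex : ∃ q, x' p < X q := ⟨N, hlt1⟩
  obtain ⟨q, hq⟩ : ∃ q, q = Nat.find hex := ⟨_, rfl⟩
  have hq1 : x' p < X q := hq ▸ Nat.find_spec hex
  have hqN : q ≤ N := hq ▸ Nat.find_min' hex hlt1
  have hqmin : ∀ r, r < q → X r ≤ x' p := fun r hr => not_lt.1 (Nat.find_min hex (hq ▸ hr))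
  have hiq : i + 1 < q := by
    by_contra hh
    have := corner_mono hmono (show q ≤ i + 1 by omega) hi
    linarith
  have hqe : X (q - 1) = x' p := le_antisymm (hqmin _ (by omega))
    (hie ▸ corner_mono hmono (show i + 1 ≤ q - 1 by omega) (by omega))
  refine ⟨i + 1, q, by omega, hiq, hqN, by simpa [hie] using hi1, by rwa [hqe], hie.trans hqe.symm,
    hsl i hi hi1 hi2, ?_⟩
  have := hsr (q - 1) (by omega) hqe.le (by rwa [Nat.sub_add_cancel (by omega)])
  rwa [Nat.sub_add_cancel (by omega)] at this

/-- The first slope of the chain that reaches s k follows one that is at most s j, because none lies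
strictly in between. A single jump therefore spans the whole gap. -/
lemma sub_le_of_chain {j k : ℕ} {m : ℝ} (hjk : j ≤ k) (hlt : s j < s k)
    (hjump : ∀ i, j ≤ i → i < k → |s (i + 1) - s i| ≤ m)
    (hgap : ∀ i, j ≤ i → i ≤ k → s i ≤ s j ∨ s k ≤ s i) : s k - s j ≤ m := by
  classical
  have hex : ∃ d, s k ≤ s (j + d) := ⟨k - j, by rw [Nat.add_sub_cancel' hjk]⟩
  obtain ⟨d, hd⟩ : ∃ d, d = Nat.find hex := ⟨_, rfl⟩
  have h1 : s k ≤ s (j + d) := hd ▸ Nat.find_spec hex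
  have hdk : d ≤ k - j := hd ▸ Nat.find_min' hex (by rw [Nat.add_sub_cancel' hjk])
  have hd0 : d ≠ 0 := by
    rintro rfl
    rw [add_zero] at h1
    linarith
  have h2 : ¬ s k ≤ s (j + (d - 1)) := Nat.find_min hex (by omega)
  have h3 := (hgap (j + (d - 1)) (by omega) (by omega)).resolve_right h2
  have h4 := (le_abs_self _).trans (hjump (j + (d - 1)) (by omega) (by omega))
  rw [show j + (d - 1) + 1 = j + d by omega] at h4
  linarith

/-- Neighbouring slopes are adjacent in `S` and `m`-close, and all slopes are bounded by `R`. -/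
structure ControlledSlopes (S : Set ℝ) (m R : ℝ) (N : ℕ) (s : ℕ → ℝ) : Prop where
  adjacent : ∀ i, 1 ≤ i → i < N → Adjacent S (s i) (s (i + 1))
  jump_le : ∀ i, 1 ≤ i → i < N → |s (i + 1) - s i| ≤ m
  abs_le : ∀ i, 1 ≤ i → i ≤ N → |s i| ≤ R

/-- Transfers the jump bound to faces that become neighbours once those between them have vanished:
adjacency keeps all the vanished slopes out of the gap. -/
lemma ControlledSlopes.jump_le_of_adjacent {m R : ℝ} (h : ControlledSlopes S m R N s) {j k : ℕ}
    (hj : 1 ≤ j) (hjk : j < k) (hk : k ≤ N) (hadj : Adjacent S (s j) (s k)) :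
    |s k - s j| ≤ m := by
  have hmem : ∀ i, j ≤ i → i ≤ k → s i ∈ S := fun i h1 h2 => by
    rcases h2.lt_or_eq with hlt | rfl
    · exact (h.adjacent i (by omega) (by omega)).1
    · exact hadj.2.1
  rcases lt_or_gt_of_ne hadj.2.2.1 with hlt | hlt
  · rw [abs_of_pos (sub_pos.2 hlt)]
    refine sub_le_of_chain hjk.le hlt (fun i h1 h2 => h.jump_le i (by omega) (by omega))
      fun i h1 h2 => ?_
    by_contra! hh
    exact hadj.not_mem_of_lt hh.1 hh.2 (hmem i h1 h2)
  · rw [abs_of_neg (sub_neg.2 hlt)]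
    have := sub_le_of_chain (s := fun i => -s i) (m := m) hjk.le (neg_lt_neg hlt)
      (fun i h1 h2 => ?_) fun i h1 h2 => ?_
    · linarith
    · rw [← abs_neg]
      convert h.jump_le i (by omega) (by omega) using 2
      ring
    · by_contra! hh
      exact hadj.symm.not_mem_of_lt (neg_lt_neg_iff.1 hh.2) (neg_lt_neg_iff.1 hh.1) (hmem i h1 h2)

end Faces

/-! ### Propagation of the slope control through event times -/

namespace Flow

variable {W : ℝ → ℝ} {S J : Set ℝ} (U : Flow W S J)

/-- The times of the `k`-th epoch. -/
def epoch (k : ℕ) : Set ℝ :=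
  {t ∈ J | U.eventTime k ≤ t ∧ (k < U.K → t < U.eventTime (k + 1))}

lemma eventTime_mono {i j : ℕ} (hij : i ≤ j) (hj : j ≤ U.K) : U.eventTime i ≤ U.eventTime j :=
  corner_mono (fun i hi => (U.eventTime_lt i hi).le) hij hj

lemma eventTime_nonneg {k : ℕ} (hk : k ≤ U.K) : 0 ≤ U.eventTime k :=
  U.eventTime_zero ▸ U.eventTime_mono (Nat.zero_le k) hk

lemma epoch_subset (k : ℕ) : U.epoch k ⊆ J := fun _ ht => ht.1

lemma epoch_eq_Ico (hJ : J.OrdConnected) (hJ0 : (0 : ℝ) ∈ J) {k : ℕ} (hk : k < U.K)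
    (hT : U.eventTime (k + 1) ∈ J) :
    U.epoch k = Ico (U.eventTime k) (U.eventTime (k + 1)) := by
  ext t
  refine ⟨fun h => ⟨h.2.1, h.2.2 hk⟩, fun h => ⟨hJ.out hJ0 hT ⟨?_, h.2.le⟩, h.1, fun _ => h.2⟩⟩
  exact (U.eventTime_nonneg hk.le).trans h.1

lemma exists_mem_epoch {t : ℝ} (ht : t ∈ J) (ht0 : 0 ≤ t) : ∃ k, k ≤ U.K ∧ t ∈ U.epoch k := by
  classical
  refine ⟨Nat.findGreatest (fun k => U.eventTime k ≤ t) U.K, Nat.findGreatest_le _, ht,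
    Nat.findGreatest_spec (P := fun k => U.eventTime k ≤ t) (Nat.zero_le _)
      (by rwa [U.eventTime_zero]), fun hlt => ?_⟩
  exact not_le.1 (Nat.findGreatest_is_greatest (P := fun k => U.eventTime k ≤ t)
    (Nat.lt_succ_self _) hlt)

/-- The coefficients `√(1 + s_i²) Δ_i` of the face velocities. -/
def faceCoeff (W : ℝ → ℝ) (s : ℕ → ℝ) (i : ℕ) : ℝ := Real.sqrt (1 + s i ^ 2) * faceDelta W s i

lemma cornerMotion (hJ : J.OrdConnected) (hJ0 : (0 : ℝ) ∈ J) {k : ℕ} (hk : k < U.K)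
    (hT : U.eventTime (k + 1) ∈ J) :
    CornerMotion (U.N k) (U.slope k) (faceCoeff W (U.slope k)) (U.corner k) (U.eventTime k)
      (U.eventTime (k + 1)) := by
  have he := U.epoch_eq_Ico hJ hJ0 hk hT
  have hf : ∀ t ∈ Ico (U.eventTime k) (U.eventTime (k + 1)), _ := fun t ht =>
    U.hasFaces k hk.le t (he.symm ▸ ht : t ∈ U.epoch k)
  refine ⟨U.eventTime_lt k hk, fun t ht => (hf t ht).first, fun t ht => (hf t ht).last,
    fun t ht => (hf t ht).strict, ?_, fun t ht i hi hiN => ?_⟩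
  · exact (hf _ ⟨le_rfl, U.eventTime_lt k hk⟩).slope_ne
  · have h1 := U.corner_deriv k hk.le t (he.symm ▸ ht : t ∈ U.epoch k) i hi hiN
    rw [faceVelocity_eq_innerVelocity, faceVelocity_eq_innerVelocity] at h1
    rw [← he]
    exact h1

/-- At the end of an epoch the flow is piecewise linear with the limits of the corners. -/
lemma sub_eq_of_tendsto (hJ : J.OrdConnected) (hJ0 : (0 : ℝ) ∈ J) {k : ℕ} (hk : k < U.K)
    (hT : U.eventTime (k + 1) ∈ J) {X : ℕ → ℝ}
    (hX : ∀ i, i ≤ U.N k →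
      Tendsto (fun t => U.corner k t i) (𝓝[<] (U.eventTime (k + 1))) (𝓝 (X i)))
    {i : ℕ} (hi : i < U.N k) {y y' : ℝ} (hy : y ∈ Ioo (X i) (X (i + 1)))
    (hy' : y' ∈ Ioo (X i) (X (i + 1))) :
    U.toFun y (U.eventTime (k + 1)) - U.toFun y' (U.eventTime (k + 1))
      = U.slope k (i + 1) * (y - y') := by
  have hM := U.cornerMotion hJ hJ0 hk hT
  have he := U.epoch_eq_Ico hJ hJ0 hk hT
  have hIco : ∀ᶠ t in 𝓝[<] (U.eventTime (k + 1)), t ∈ U.epoch k :=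
    he ▸ Filter.mem_of_superset (Ioo_mem_nhdsLT hM.lt) Ioo_subset_Ico_self
  have h01 : ∀ j, j ≤ U.N k → X j ∈ Icc (0 : ℝ) 1 := fun j hj => by
    refine isClosed_Icc.mem_of_tendsto (hX j hj) (hIco.mono fun t ht => ?_)
    exact hM.mem_Icc (he ▸ ht) hj
  have hcont : ∀ z ∈ Ioo (X i) (X (i + 1)), Tendsto (fun t => U.toFun z t)
      (𝓝[<] (U.eventTime (k + 1))) (𝓝 (U.toFun z (U.eventTime (k + 1)))) := fun z hz => by
    have hz' : z ∈ Icc (0 : ℝ) 1 :=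
      ⟨(h01 i hi.le).1.trans hz.1.le, hz.2.le.trans (h01 (i + 1) hi).2⟩
    refine (continuousOn_time_slice U.continuousOn hz' _ hT).mono_left ?_
    exact nhdsWithin_le_iff.2 (hIco.mono fun t ht => ht.1)
  refine tendsto_nhds_unique ((hcont y hy).sub (hcont y' hy')) (tendsto_const_nhds.congr' ?_)
  filter_upwards [hIco, (hX i hi.le).eventually_lt_const hy.1,
    (hX i hi.le).eventually_lt_const hy'.1, (hX (i + 1) hi).eventually_const_lt hy.2,
    (hX (i + 1) hi).eventually_const_lt hy'.2] with t ht h1 h2 h3 h4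
  exact ((U.hasFaces k hk.le t ht).sub_eq hi ⟨h1.le, h3.le⟩ ⟨h2.le, h4.le⟩).symm

lemma mem_epoch_start {k : ℕ} (hT : U.eventTime k ∈ J) : U.eventTime k ∈ U.epoch k :=
  ⟨hT, le_rfl, fun h => U.eventTime_lt k h⟩

/-- Every corner of the new epoch arises from two surviving faces of the old one, with everything
between them collapsed. Those faces have adjacent slopes by `CornerMotion.adjacent_of_collapse`,
whose sign conditions on the velocities come from W'' > 0, and the bounds are inherited from the old
slopes. -/
lemma controlledSlopes_succ (hW : ContDiff ℝ 2 W) (hWconv : ∀ p, 0 < iteratedDeriv 2 W p)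
    (hJ : J.OrdConnected) (hJ0 : (0 : ℝ) ∈ J) {k : ℕ} (hk : k < U.K)
    (hT : U.eventTime (k + 1) ∈ J) {m R : ℝ} (hR : 0 ≤ R)
    (h : ControlledSlopes S m R (U.N k) (U.slope k)) :
    ControlledSlopes S m R (U.N (k + 1)) (U.slope (k + 1)) := by
  have hM := U.cornerMotion hJ hJ0 hk hT
  obtain ⟨X, hX⟩ := hM.exists_tendsto
  have hIco : ∀ᶠ t in 𝓝[<] (U.eventTime (k + 1)), t ∈ Ico (U.eventTime k) (U.eventTime (k + 1)) :=
    Filter.mem_of_superset (Ioo_mem_nhdsLT hM.lt) Ioo_subset_Ico_self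
  have hX0 : X 0 = 0 := tendsto_nhds_unique (hX 0 (Nat.zero_le _))
    (tendsto_const_nhds.congr' (hIco.mono fun t ht => (hM.first t ht).symm))
  have hXN : X (U.N k) = 1 := tendsto_nhds_unique (hX _ le_rfl)
    (tendsto_const_nhds.congr' (hIco.mono fun t ht => (hM.last t ht).symm))
  have hF := U.hasFaces (k + 1) hk _ (U.mem_epoch_start hT)
  have key := fun p hp hpN => exists_collapsed (p := p) hX0 hXN (fun i hi => hM.limit_mono hX hi)
    (fun i hi y hy y' hy' => U.sub_eq_of_tendsto hJ hJ0 hk hT hX hi hy hy') hF hp hpN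
  have hs : ∀ i, 0 < Real.sqrt (1 + U.slope k i ^ 2) := fun i => Real.sqrt_pos.2 (by positivity)
  have hadj : ∀ i, 1 ≤ i → i < U.N (k + 1) → ∃ j l, 1 ≤ j ∧ j < l ∧ l ≤ U.N k ∧
      U.slope k j = U.slope (k + 1) i ∧ U.slope k l = U.slope (k + 1) (i + 1) ∧
      Adjacent S (U.slope k j) (U.slope k l) := fun i hi hiN => by
    obtain ⟨j, l, hj, hjl, hl, h1, h2, h3, h4, h5⟩ := key i hi hiN
    refine ⟨j, l, hj, hjl, hl, h4, h5, hM.adjacent_of_collapse hX h.adjacent ?_ ?_ ?_ hj hjl hl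
      h1 h2 h3 (h4 ▸ h5 ▸ hF.slope_ne i hi hiN)⟩
    · intro i _ _ h6 h7
      obtain ⟨ξ, -, e⟩ := exists_faceDelta_eq hW (.inl ⟨h6, h7⟩)
      rw [faceCoeff, e]
      exact mul_pos (hs i) (mul_pos (hWconv ξ) (by linarith))
    · intro i _ _ h6 h7
      obtain ⟨ξ, -, e⟩ := exists_faceDelta_eq hW (.inr (.inl ⟨h6, h7⟩))
      rw [faceCoeff, e]
      exact mul_neg_of_pos_of_neg (hs i) (mul_neg_of_pos_of_neg (hWconv ξ) (by linarith))
    · intro i _ _ h6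
      obtain ⟨ξ, -, e⟩ := exists_faceDelta_eq hW (.inr (.inr h6))
      rw [faceCoeff, e, h6]
      simp
  refine ⟨fun i hi hiN => ?_, fun i hi hiN => ?_, fun i hi hiN => ?_⟩
  · obtain ⟨j, l, -, -, -, h1, h2, h3⟩ := hadj i hi hiN
    rwa [h1, h2] at h3
  · obtain ⟨j, l, hj, hjl, hl, h1, h2, h3⟩ := hadj i hi hiN
    rw [← h1, ← h2]
    exact h.jump_le_of_adjacent hj hjl hl h3
  · rcases hiN.lt_or_eq with hlt | e
    · obtain ⟨j, l, hj, hjl, hl, h1, h2, h3⟩ := hadj i hi hlt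
      rw [← h1]
      exact h.abs_le j hj (by omega)
    rcases hi.lt_or_eq with hlt | e'
    · obtain ⟨j, l, hj, hjl, hl, h1, h2, h3⟩ := hadj (i - 1) (by omega) (by omega)
      rw [Nat.sub_add_cancel hi] at h2
      rw [← h2]
      exact h.abs_le l (by omega) hl
    -- With a single face there is no corner to trace back; the boundary values force slope 0.
    · subst e'
      rw [← e] at hF
      rw [hF.slope_eq_zero_of_one (U.boundary_left _ hT) (U.boundary_right _ hT), abs_zero]
      exact hR

lemma controlledSlopes (hW : ContDiff ℝ 2 W) (hWconv : ∀ p, 0 < iteratedDeriv 2 W p)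
    (hJ : J.OrdConnected) (hJ0 : (0 : ℝ) ∈ J) {m R : ℝ} (hR : 0 ≤ R)
    (h : ControlledSlopes S m R (U.N 0) (U.slope 0)) {k : ℕ} (hk : k ≤ U.K)
    (hT : U.eventTime k ∈ J) : ControlledSlopes S m R (U.N k) (U.slope k) := by
  induction k with
  | zero => exact h
  | succ k ih =>
    refine U.controlledSlopes_succ hW hWconv hJ hJ0 hk hT hR (ih (by omega) ?_)
    exact hJ.out hJ0 hT ⟨U.eventTime_nonneg (by omega), U.eventTime_mono (Nat.le_succ k) hk⟩

/-- The slopes of the flow are controlled initially. -/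
lemma controlledSlopes_zero (hJ0 : (0 : ℝ) ∈ J) {u : ℝ → ℝ → ℝ} {m B : ℝ}
    (hU : InitiallyClose u U m) (hB : ∀ x ∈ Icc (0 : ℝ) 1, |spaceDeriv u x 0| ≤ B) :
    ControlledSlopes S m (B + m) (U.N 0) (U.slope 0) := by
  refine ⟨U.initial_adjacent, hU.jump_le, fun i hi hiN => ?_⟩
  have h0 : (0 : ℝ) ∈ U.epoch 0 := by
    have := U.mem_epoch_start (k := 0) (by rwa [U.eventTime_zero])
    rwa [U.eventTime_zero] at this
  have hF := U.hasFaces 0 (Nat.zero_le _) 0 h0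
  obtain ⟨i, rfl⟩ := Nat.exists_eq_add_of_le' hi
  obtain ⟨y, hy⟩ := nonempty_Ioo.2 (hF.strict i hiN)
  have hy1 : y ∈ Icc (0 : ℝ) 1 :=
    ⟨(hF.mem_Icc (by omega)).1.trans hy.1.le, hy.2.le.trans (hF.mem_Icc hiN).2⟩
  have h1 := hU.slope_close y hy1 (hF.hasDerivAt hiN hy).differentiableAt.differentiableWithinAt
  have h2 : spaceDeriv U.toFun y 0 = U.slope 0 (i + 1) := hF.derivWithin_eq hiN hy
  rw [h2] at h1
  have h3 := abs_sub_abs_le_abs_sub (U.slope 0 (i + 1)) (spaceDeriv u y 0)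
  linarith [hB y hy1]

end Flow

/-! ### The energy as an explicit function of the corners -/

section Energy

variable {S : Set ℝ} {f : ℝ → ℝ} {N : ℕ} {s x : ℕ → ℝ}

lemma sum_range_mul_sub (a b : ℕ → ℝ) {N : ℕ} (hN : 1 ≤ N) :
    ∑ i ∈ Finset.range N, a (i + 1) * (b (i + 1) - b i)
      = a N * b N - a 1 * b 0 - ∑ i ∈ Finset.Ico 1 N, (a (i + 1) - a i) * b i := by
  induction N, hN using Nat.le_induction with
  | base => simp; ring
  | succ n hn ih =>
    rw [Finset.sum_range_succ, ih, Finset.sum_Ico_succ_top hn]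
    ring

lemma HasFaces.intervalIntegrable_face (hF : HasFaces S f N s x) {p : ℝ → ℝ}
    (hp : ContinuousOn p (Icc 0 1)) {i : ℕ} (hi : i < N) :
    IntervalIntegrable p volume (x i) (x (i + 1)) := by
  refine (hp.mono ?_).intervalIntegrable
  rw [uIcc_of_le (hF.strict i hi).le]
  exact Icc_subset_Icc (hF.mem_Icc hi.le).1 (hF.mem_Icc hi).2

/-- The energy integral of a function against a piecewise linear one is a sum over the faces. -/
lemma HasFaces.half_integral_eq_sum (hF : HasFaces S f N s x) {p : ℝ → ℝ}
    (hp : ContinuousOn p (Icc 0 1)) :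
    (1 / 2) * ∫ y in (0 : ℝ)..1, |p y - derivWithin f (Icc 0 1) y| ^ 2
      = (1 / 2) * ∑ i ∈ Finset.range N, ∫ y in (x i)..(x (i + 1)), (p y - s (i + 1)) ^ 2 := by
  have hc : ∀ i, i < N → ∀ᵐ y, y ∈ uIoc (x i) (x (i + 1)) →
      (p y - s (i + 1)) ^ 2 = |p y - derivWithin f (Icc 0 1) y| ^ 2 := fun i hi => by
    have hne : ∀ᵐ y : ℝ, y ≠ x (i + 1) := by simp [ae_iff, measure_singleton]
    filter_upwards [hne] with y hy hyI
    rw [uIoc_of_le (hF.strict i hi).le] at hyI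
    rw [hF.derivWithin_eq hi ⟨hyI.1, lt_of_le_of_ne hyI.2 hy⟩, sq_abs]
  have hint : ∀ i, i < N →
      IntervalIntegrable (fun y => |p y - derivWithin f (Icc 0 1) y| ^ 2) volume (x i) (x (i + 1)) :=
    fun i hi => by
      refine (hF.intervalIntegrable_face (p := fun y => (p y - s (i + 1)) ^ 2)
        (by fun_prop) hi).congr_ae ?_
      exact (ae_restrict_iff' measurableSet_uIoc).2 (hc i hi)
  have := intervalIntegral.sum_integral_adjacent_intervals (a := x) (n := N) hint
  rw [hF.first, hF.last] at this
  rw [← this]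
  congr 1
  refine Finset.sum_congr rfl fun i hi => ?_
  exact (intervalIntegral.integral_congr_ae (hc i (Finset.mem_range.1 hi))).symm

/-- Summation by parts in the energy integral. -/
lemma HasFaces.half_integral_eq (hF : HasFaces S f N s x) {g p : ℝ → ℝ}
    (hp : ContinuousOn p (Icc 0 1)) (hg : ∀ y ∈ Icc (0 : ℝ) 1, HasDerivWithinAt g (p y) (Icc 0 1) y)
    (h0 : g 0 = 0) (h1 : g 1 = 0) :
    (1 / 2) * ∫ y in (0 : ℝ)..1, |p y - derivWithin f (Icc 0 1) y| ^ 2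
      = (1 / 2) * (∫ y in (0 : ℝ)..1, p y ^ 2)
        + ∑ i ∈ Finset.Ico 1 N, (s (i + 1) - s i) * g (x i)
        + (1 / 2) * s N ^ 2 - (1 / 2) * ∑ i ∈ Finset.Ico 1 N, (s (i + 1) ^ 2 - s i ^ 2) * x i := by
  rw [hF.half_integral_eq_sum hp]
  -- The slope is constant on a face, so the cross term integrates exactly to an increment of g.
  -- Abel summation then moves everything to the corners.
  have hface : ∀ i ∈ Finset.range N, ∫ y in (x i)..(x (i + 1)), (p y - s (i + 1)) ^ 2
      = (∫ y in (x i)..(x (i + 1)), p y ^ 2) - 2 * (s (i + 1) * (g (x (i + 1)) - g (x i)))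
        + s (i + 1) ^ 2 * (x (i + 1) - x i) := fun i hi => by
    replace hi := Finset.mem_range.1 hi
    have hsub : Icc (x i) (x (i + 1)) ⊆ Icc 0 1 :=
      Icc_subset_Icc (hF.mem_Icc hi.le).1 (hF.mem_Icc hi).2
    have e1 : ∫ y in (x i)..(x (i + 1)), p y = g (x (i + 1)) - g (x i) := by
      have hle := (hF.strict i hi).le
      refine intervalIntegral.integral_eq_sub_of_hasDerivAt_of_le hle
        (fun y hy => ((hg y (hsub hy)).continuousWithinAt.mono hsub)) (fun y hy => ?_)
        (hF.intervalIntegrable_face hp hi)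
      exact (hg y (hsub (Ioo_subset_Icc_self hy))).hasDerivAt
        (Filter.mem_of_superset (Icc_mem_nhds hy.1 hy.2) hsub)
    have e2 : ∀ y, (p y - s (i + 1)) ^ 2 = p y ^ 2 - 2 * s (i + 1) * p y + s (i + 1) ^ 2 :=
      fun y => by ring
    have i1 := hF.intervalIntegrable_face (p := fun y => p y ^ 2) (by fun_prop) hi
    have i2 := (hF.intervalIntegrable_face hp hi).const_mul (2 * s (i + 1))
    simp only [e2]
    rw [intervalIntegral.integral_add (i1.sub i2) intervalIntegrable_const,
      intervalIntegral.integral_sub i1 i2, intervalIntegral.integral_const_mul, e1,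
      intervalIntegral.integral_const, smul_eq_mul]
    ring
  have hadj := intervalIntegral.sum_integral_adjacent_intervals (a := x) (n := N)
    (f := fun y => p y ^ 2) fun i hi => hF.intervalIntegrable_face (by fun_prop) hi
  have p1 := sum_range_mul_sub s (fun i => g (x i)) hF.pos
  have p2 := sum_range_mul_sub (fun i => s i ^ 2) x hF.pos
  rw [hF.first, hF.last] at hadj p2
  simp only [hF.first, hF.last, h0, h1] at p1
  rw [Finset.sum_congr rfl hface, Finset.sum_add_distrib, Finset.sum_sub_distrib, hadj,
    ← Finset.mul_sum, p1, p2]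
  ring

end Energy

/-! ### Estimates on a single face -/

section Rate

/-- By compactness of [-R,R]: c is the minimum of W'', as the square root is at least 1. For K, W''
is Lipschitz because W is C³, and √(1+y²) is 1-Lipschitz and at most 1 + R. -/
lemma exists_coefficient_bounds {W : ℝ → ℝ} (hW : ContDiff ℝ 3 W)
    (hWconv : ∀ p, 0 < iteratedDeriv 2 W p) {R : ℝ} (hR : 0 ≤ R) :
    ∃ c K, 0 < c ∧ 0 ≤ K ∧ ∀ p s ξ : ℝ, |p| ≤ R → |s| ≤ R → |ξ| ≤ R →
      c ≤ Real.sqrt (1 + s ^ 2) * iteratedDeriv 2 W ξ ∧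
      |Real.sqrt (1 + p ^ 2) * iteratedDeriv 2 W p - Real.sqrt (1 + s ^ 2) * iteratedDeriv 2 W ξ|
        ≤ K * (|p - s| + |ξ - s|) := by
  have h2 : ContDiff ℝ 1 (iteratedDeriv 2 W) := by
    rw [iteratedDeriv_eq_iterate]
    exact ContDiff.iterate_deriv' 1 2 (hW.of_le (by norm_num))
  have hcomp : IsCompact (Icc (-R) R) := isCompact_Icc
  have hne : (Icc (-R) R).Nonempty := ⟨0, by simpa using hR⟩
  obtain ⟨z, -, hz⟩ := hcomp.exists_isMinOn hne h2.continuous.continuousOn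
  obtain ⟨B, hB⟩ := hcomp.exists_bound_of_continuousOn h2.continuous.continuousOn
  obtain ⟨L, hL⟩ := hcomp.exists_bound_of_continuousOn
    (h2.continuous_deriv le_rfl).continuousOn
  have hL0 : 0 ≤ L := (norm_nonneg _).trans (hL 0 (by simpa using hR))
  have hB0 : 0 ≤ B := (norm_nonneg _).trans (hB 0 (by simpa using hR))
  refine ⟨iteratedDeriv 2 W z, (1 + R) * L + B, hWconv z, by positivity,
    fun p s ξ hp hs hξ => ⟨?_, ?_⟩⟩
  · have h1 : 1 ≤ Real.sqrt (1 + s ^ 2) := Real.one_le_sqrt.2 (by nlinarith [sq_nonneg s])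
    have h3 : iteratedDeriv 2 W z ≤ iteratedDeriv 2 W ξ := hz (abs_le.1 hξ)
    nlinarith [hWconv ξ]
  · have a1 : |iteratedDeriv 2 W p - iteratedDeriv 2 W ξ| ≤ L * |p - ξ| :=
      (convex_Icc (-R) R).norm_image_sub_le_of_norm_deriv_le
        (fun y _ => h2.differentiable one_ne_zero y) hL (abs_le.1 hξ) (abs_le.1 hp)
    have a2 : |iteratedDeriv 2 W ξ| ≤ B := hB ξ (abs_le.1 hξ)
    have hsq : ∀ y : ℝ, Real.sqrt (1 + y ^ 2) ^ 2 = 1 + y ^ 2 := fun y =>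
      Real.sq_sqrt (by positivity)
    have hpos : ∀ y : ℝ, 0 ≤ Real.sqrt (1 + y ^ 2) := fun y => Real.sqrt_nonneg _
    have a3 : Real.sqrt (1 + p ^ 2) ≤ 1 + R := by
      rw [Real.sqrt_le_left (by linarith)]
      have := sq_le_sq' (abs_le.1 hp).1 (abs_le.1 hp).2
      nlinarith
    have a4 : |Real.sqrt (1 + p ^ 2) - Real.sqrt (1 + s ^ 2)| ≤ |p - s| := by
      have hge : ∀ y : ℝ, |y| ≤ Real.sqrt (1 + y ^ 2) := fun y =>
        Real.abs_le_sqrt (by linarith)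
      have hge1 : 1 ≤ Real.sqrt (1 + p ^ 2) := Real.one_le_sqrt.2 (by nlinarith [sq_nonneg p])
      have e : (Real.sqrt (1 + p ^ 2) - Real.sqrt (1 + s ^ 2))
          * (Real.sqrt (1 + p ^ 2) + Real.sqrt (1 + s ^ 2)) = (p - s) * (p + s) := by
        linear_combination hsq p - hsq s
      have e' := congrArg abs e
      rw [abs_mul, abs_mul, abs_of_nonneg (add_nonneg (hpos p) (hpos s))] at e'
      have h5 : |p + s| ≤ Real.sqrt (1 + p ^ 2) + Real.sqrt (1 + s ^ 2) :=
        (abs_add_le p s).trans (add_le_add (hge p) (hge s))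
      refine le_of_mul_le_mul_right (e'.trans_le ?_)
        (show 0 < Real.sqrt (1 + p ^ 2) + Real.sqrt (1 + s ^ 2) by linarith [hpos s])
      exact mul_le_mul_of_nonneg_left h5 (abs_nonneg _)
    have e : Real.sqrt (1 + p ^ 2) * iteratedDeriv 2 W p
        - Real.sqrt (1 + s ^ 2) * iteratedDeriv 2 W ξ
        = Real.sqrt (1 + p ^ 2) * (iteratedDeriv 2 W p - iteratedDeriv 2 W ξ)
          + (Real.sqrt (1 + p ^ 2) - Real.sqrt (1 + s ^ 2)) * iteratedDeriv 2 W ξ := by ring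
    have a5 : |p - ξ| ≤ |p - s| + |ξ - s| := by
      rw [abs_sub_comm ξ s]
      exact abs_sub_le p s ξ
    rw [e]
    refine (abs_add_le _ _).trans ?_
    rw [abs_mul, abs_mul, abs_of_nonneg (hpos p)]
    calc _ ≤ (1 + R) * (L * (|p - s| + |ξ - s|)) + |p - s| * B := by
          gcongr
          exact a1.trans (by gcongr)
      _ ≤ _ := by nlinarith [mul_nonneg hB0 (abs_nonneg (ξ - s))]

/-- The left side is -Q(σ-a)² + (q-Q) a (σ-a); completing the square leaves ((q-Q) a)²/(4Q). There
is no bound on σ, which can be large on short faces, so it has to be absorbed entirely by the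
square. -/
lemma quadratic_bound {q Q a σ c K B e m : ℝ} (hc : 0 < c) (hQ : c ≤ Q)
    (hqQ : |q - Q| ≤ K * (e + m)) (ha : |a| ≤ B) (hm0 : 0 ≤ m)
    (hm : m ≤ 1) :
    -(q * a * a) + σ * (q * a) + Q * σ * a - Q * σ ^ 2
      ≤ K ^ 2 * B ^ 2 / (2 * c) * (e ^ 2 + m) := by
  have hQ0 : 0 < Q := hc.trans_le hQ
  have hB0 : 0 ≤ B := (abs_nonneg a).trans ha
  have h1 : -(q * a * a) + σ * (q * a) + Q * σ * a - Q * σ ^ 2 ≤ ((q - Q) * a) ^ 2 / (4 * Q) := by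
    rw [le_div_iff₀ (by positivity)]
    nlinarith [sq_nonneg ((q - Q) * a - 2 * Q * (σ - a))]
  have h2 : ((q - Q) * a) ^ 2 ≤ (K * (e + m) * B) ^ 2 := by
    rw [← sq_abs ((q - Q) * a), abs_mul]
    gcongr
    exact (abs_nonneg _).trans hqQ
  have h3 : (e + m) ^ 2 ≤ 2 * (e ^ 2 + m) := by nlinarith [sq_nonneg (e - m)]
  refine h1.trans ?_
  calc ((q - Q) * a) ^ 2 / (4 * Q) ≤ (K * (e + m) * B) ^ 2 / (4 * c) := by gcongr
    _ = K ^ 2 * B ^ 2 * (e + m) ^ 2 / (4 * c) := by ring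
    _ ≤ K ^ 2 * B ^ 2 * (2 * (e ^ 2 + m)) / (4 * c) := by gcongr
    _ = _ := by field_simp; ring

/-- The contribution of an inner face `[α, β]` of slope `s₀`, with neighbouring slope jumps `d` and
`d'`, to the rate of change of the energy. -/
lemma inner_face_bound {p a w q : ℝ → ℝ} {α β s₀ d d' Q c K B L m : ℝ} (hαβ : α < β)
    (hp : ∀ y ∈ Icc α β, HasDerivWithinAt p (a y) (Icc α β) y)
    (ha : ContinuousOn a (Icc α β)) (hw : ContinuousOn w (Icc α β))
    (hwq : ∀ y ∈ Icc α β, w y = q y * a y) (haB : ∀ y ∈ Icc α β, |a y| ≤ B)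
    (hL : ∀ y ∈ Icc α β, ∀ z ∈ Icc α β, |w y - w z| ≤ L * |y - z|)
    (hc : 0 < c) (hQ : c ≤ Q) (hL0 : 0 ≤ L)
    (hqQ : ∀ y ∈ Icc α β, |q y - Q| ≤ K * (|p y - s₀| + m)) (hm0 : 0 ≤ m) (hm : m ≤ 1)
    (hd : |d| ≤ m) (hd' : |d'| ≤ m) :
    -(∫ y in α..β, w y * a y) + (1 / 2) * d * w α + (1 / 2) * d' * w β
        + Q * ((d + d') / 2) / (β - α) * (p β - p α - (d + d') / 2)
      ≤ K ^ 2 * B ^ 2 / (2 * c) * (∫ y in α..β, (p y - s₀) ^ 2)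
        + (K ^ 2 * B ^ 2 / (2 * c) + L) * m * (β - α) := by
  have hl : 0 < β - α := sub_pos.2 hαβ
  have hpc : ContinuousOn p (Icc α β) := fun y hy => (hp y hy).continuousWithinAt
  have hI : ∀ {g : ℝ → ℝ}, ContinuousOn g (Icc α β) → IntervalIntegrable g volume α β :=
    fun hg => ContinuousOn.intervalIntegrable (by rwa [uIcc_of_le hαβ.le])
  obtain ⟨σ, hσ⟩ : ∃ σ, σ = (d + d') / 2 / (β - α) := ⟨_, rfl⟩
  have hσl : σ * (β - α) = (d + d') / 2 := by rw [hσ, div_mul_cancel₀ _ hl.ne']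
  have hint : ∫ y in α..β, a y = p β - p α :=
    intervalIntegral.integral_eq_sub_of_hasDerivAt_of_le hαβ.le hpc
      (fun y hy => (hp y (Ioo_subset_Icc_self hy)).hasDerivAt (Icc_mem_nhds hy.1 hy.2)) (hI ha)
  -- The terms without an integral, spread evenly over the face, so that both sides can be compared
  -- pointwise.
  obtain ⟨M, hM⟩ : ∃ M, M = ((1 / 2) * d * w α + (1 / 2) * d' * w β) / (β - α) - Q * σ ^ 2 :=
    ⟨_, rfl⟩
  have e : -(∫ y in α..β, w y * a y) + (1 / 2) * d * w α + (1 / 2) * d' * w β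
        + Q * ((d + d') / 2) / (β - α) * (p β - p α - (d + d') / 2)
      = ∫ y in α..β, (-(w y * a y) + Q * σ * a y + M) := by
    have i1 : IntervalIntegrable (fun y => -(w y * a y)) volume α β := (hI (hw.mul ha)).neg
    have i2 : IntervalIntegrable (fun y => Q * σ * a y) volume α β := (hI ha).const_mul _
    rw [intervalIntegral.integral_add (i1.add i2) intervalIntegrable_const,
      intervalIntegral.integral_add i1 i2,
      intervalIntegral.integral_neg, intervalIntegral.integral_const_mul, hint,
      intervalIntegral.integral_const, smul_eq_mul]
    have e1 : (β - α) * M = (1 / 2) * d * w α + (1 / 2) * d' * w β - Q * σ * (σ * (β - α)) := by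
      rw [hM]
      field_simp
    rw [e1, hσl, show Q * ((d + d') / 2) / (β - α) = Q * σ by rw [hσ]; ring]
    ring
  have e' : K ^ 2 * B ^ 2 / (2 * c) * (∫ y in α..β, (p y - s₀) ^ 2)
        + (K ^ 2 * B ^ 2 / (2 * c) + L) * m * (β - α)
      = ∫ y in α..β, (K ^ 2 * B ^ 2 / (2 * c) * (p y - s₀) ^ 2
        + (K ^ 2 * B ^ 2 / (2 * c) + L) * m) := by
    rw [intervalIntegral.integral_add ((hI (by fun_prop)).const_mul _) intervalIntegrable_const,
      intervalIntegral.integral_const_mul, intervalIntegral.integral_const, smul_eq_mul]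
    ring
  rw [e, e']
  refine intervalIntegral.integral_mono_on hαβ.le (hI (by fun_prop)) (hI (by fun_prop))
    fun y hy => ?_
  have h1 := quadratic_bound (σ := σ) hc hQ (hqQ y hy) (haB y hy) hm0 hm
  rw [sq_abs, ← hwq y hy] at h1
  -- Replacing the endpoint values of w by w y costs at most L(β - α), which cancels the division by
  -- the face length.
  have hside : ∀ b z, |b| ≤ m → z ∈ Icc α β →
      (1 / 2) * b / (β - α) * (w z - w y) ≤ (1 / 2) * (L * m) := fun b z hb hz => by
    refine (le_abs_self _).trans ?_
    have h2 : |z - y| ≤ β - α := abs_sub_le_iff.2 ⟨by linarith [hz.2, hy.1], by linarith [hz.1, hy.2]⟩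
    rw [abs_mul, abs_div, abs_mul, abs_of_pos hl, abs_of_pos (one_half_pos (α := ℝ))]
    calc 1 / 2 * |b| / (β - α) * |w z - w y| ≤ 1 / 2 * m / (β - α) * (L * (β - α)) := by
          gcongr
          exact (hL z hz y hy).trans (by gcongr)
      _ = _ := by field_simp
  have h2 := hside d α hd ⟨le_rfl, hαβ.le⟩
  have h3 := hside d' β hd' ⟨hαβ.le, le_rfl⟩
  have h4 : M = 1 / 2 * d / (β - α) * (w α - w y) + 1 / 2 * d' / (β - α) * (w β - w y)
      + σ * w y - Q * σ ^ 2 := by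
    rw [hM, hσ]
    ring
  rw [h4]
  linarith

/-- Distribution of terms at the corners over the two neighbouring faces. -/
lemma sum_faces_le {N : ℕ} (hN : 1 ≤ N) {I E l r : ℕ → ℝ} {M : ℝ}
    (hmid : ∀ i, 1 ≤ i → i + 1 < N → I i + r i + l (i + 1) ≤ E i)
    (hfirst : I 0 ≤ E 0) (hlast : I (N - 1) ≤ E (N - 1))
    (hl : 2 ≤ N → l 1 ≤ M) (hr : 2 ≤ N → r (N - 1) ≤ M) (hM : 0 ≤ M) :
    ∑ i ∈ Finset.range N, I i + ∑ i ∈ Finset.Ico 1 N, (l i + r i)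
      ≤ ∑ i ∈ Finset.range N, E i + 2 * M := by
  rcases (show N = 1 ∨ 2 ≤ N by omega) with rfl | h2
  · simp
    linarith
  obtain ⟨n, rfl⟩ := Nat.exists_eq_add_of_le' h2
  have e1 : ∀ g : ℕ → ℝ, ∑ i ∈ Finset.range (n + 2), g i
      = g 0 + ∑ i ∈ Finset.range n, g (i + 1) + g (n + 1) := fun g => by
    rw [Finset.sum_range_succ, Finset.sum_range_succ']
    ring
  have e2 : ∑ i ∈ Finset.Ico 1 (n + 2), (l i + r i)
      = l 1 + ∑ i ∈ Finset.range n, (r (i + 1) + l (i + 2)) + r (n + 1) := by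
    rw [Finset.sum_Ico_eq_sum_range, show n + 2 - 1 = n + 1 by omega, Finset.sum_add_distrib,
      Finset.sum_range_succ', Finset.sum_range_succ (fun i => r (1 + i)), Finset.sum_add_distrib]
    simp only [add_comm 1, add_assoc, Nat.reduceAdd, zero_add]
    ring
  have h3 : ∑ i ∈ Finset.range n, I (i + 1) + ∑ i ∈ Finset.range n, (r (i + 1) + l (i + 2))
      ≤ ∑ i ∈ Finset.range n, E (i + 1) := by
    rw [← Finset.sum_add_distrib]
    refine Finset.sum_le_sum fun i hi => ?_
    have := hmid (i + 1) (by omega) (by have := Finset.mem_range.1 hi; omega)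
    linarith
  have h4 := hl h2
  have h5 := hr h2
  rw [e1, e1, e2]
  simp only [show n + 2 - 1 = n + 1 by omega] at hlast h5
  linarith

end Rate

/-! ### Summation over the faces -/

section RateBound

variable {S : Set ℝ} {f : ℝ → ℝ} {N : ℕ} {s x : ℕ → ℝ}

lemma faceVelocity_one (W : ℝ → ℝ) : faceVelocity W N s x 1 = 0 := by simp [faceVelocity]

lemma faceVelocity_last (W : ℝ → ℝ) : faceVelocity W N s x N = 0 := by simp [faceVelocity]

/-- Each corner term is shared between its two faces: half of the w-term goes to each, and each
velocity to its own face. Inner faces then fall under `inner_face_bound`. End faces have zero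
velocity, so their shares cost only O(m). -/
lemma rate_le {W : ℝ → ℝ} (hW : ContDiff ℝ 2 W) (hF : HasFaces S f N s x) {m R : ℝ}
    (hs : ControlledSlopes S m R N s) (hm0 : 0 ≤ m) (hm : m ≤ 1) {p a w : ℝ → ℝ}
    (hp : ∀ y ∈ Icc (0 : ℝ) 1, HasDerivWithinAt p (a y) (Icc 0 1) y)
    (ha : ContinuousOn a (Icc 0 1)) (hw : ContinuousOn w (Icc 0 1))
    (hwq : ∀ y ∈ Icc (0 : ℝ) 1, w y = Real.sqrt (1 + p y ^ 2) * iteratedDeriv 2 W (p y) * a y)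
    {B L c K : ℝ} (haB : ∀ y ∈ Icc (0 : ℝ) 1, |a y| ≤ B) (hwB : ∀ y ∈ Icc (0 : ℝ) 1, |w y| ≤ B)
    (hL : ∀ y ∈ Icc (0 : ℝ) 1, ∀ z ∈ Icc (0 : ℝ) 1, |w y - w z| ≤ L * |y - z|)
    (hpR : ∀ y ∈ Icc (0 : ℝ) 1, |p y| ≤ R) (hL0 : 0 ≤ L) (hc : 0 < c) (hK : 0 ≤ K)
    (hcK : ∀ p s ξ : ℝ, |p| ≤ R → |s| ≤ R → |ξ| ≤ R →
      c ≤ Real.sqrt (1 + s ^ 2) * iteratedDeriv 2 W ξ ∧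
      |Real.sqrt (1 + p ^ 2) * iteratedDeriv 2 W p - Real.sqrt (1 + s ^ 2) * iteratedDeriv 2 W ξ|
        ≤ K * (|p - s| + |ξ - s|)) :
    -(∫ y in (0 : ℝ)..1, w y * a y) + ∑ i ∈ Finset.Ico 1 N, ((s (i + 1) - s i) * w (x i)
        - (faceVelocity W N s x (i + 1) - faceVelocity W N s x i)
          * (p (x i) - (s i + s (i + 1)) / 2))
      ≤ K ^ 2 * B ^ 2 / (2 * c)
          * (∑ i ∈ Finset.range N, ∫ y in (x i)..(x (i + 1)), (p y - s (i + 1)) ^ 2)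
        + (K ^ 2 * B ^ 2 / (2 * c) + L + B) * m := by
  have hB0 : 0 ≤ B := (abs_nonneg _).trans (haB 0 (by simp))
  set v := faceVelocity W N s x with hv
  set G := K ^ 2 * B ^ 2 / (2 * c) with hG
  have hG0 : 0 ≤ G := by positivity
  have hsub : ∀ i, i < N → Icc (x i) (x (i + 1)) ⊆ Icc 0 1 := fun i hi =>
    Icc_subset_Icc (hF.mem_Icc hi.le).1 (hF.mem_Icc hi).2
  have hadj := intervalIntegral.sum_integral_adjacent_intervals (a := x) (n := N)
    (f := fun y => w y * a y) fun i hi => hF.intervalIntegrable_face (by fun_prop) hi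
  rw [hF.first, hF.last] at hadj
  -- Without a velocity term the dissipation alone has the right sign, since w a = q a² ≥ 0.
  have hend : ∀ i, i < N → -(∫ y in (x i)..(x (i + 1)), w y * a y)
      ≤ G * (∫ y in (x i)..(x (i + 1)), (p y - s (i + 1)) ^ 2)
        + (G + L) * m * (x (i + 1) - x i) := fun i hi => by
    have hle := (hF.strict i hi).le
    have h1 : 0 ≤ ∫ y in (x i)..(x (i + 1)), w y * a y :=
      intervalIntegral.integral_nonneg hle fun y hy => by
        have hy' := hsub i hi hy
        have h2 := (hcK (p y) (p y) (p y) (hpR y hy') (hpR y hy') (hpR y hy')).1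
        rw [hwq y hy', mul_assoc]
        exact mul_nonneg (hc.le.trans h2) (mul_self_nonneg _)
    have h2 : 0 ≤ ∫ y in (x i)..(x (i + 1)), (p y - s (i + 1)) ^ 2 :=
      intervalIntegral.integral_nonneg hle fun y _ => sq_nonneg _
    have h3 : 0 ≤ (G + L) * m * (x (i + 1) - x i) :=
      mul_nonneg (by positivity) (sub_nonneg.2 hle)
    nlinarith [mul_nonneg hG0 h2]
  have hside : ∀ i, 1 ≤ i → i < N → (1 / 2) * (s (i + 1) - s i) * w (x i) ≤ m * B / 2 :=
    fun i hi hiN => by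
      have h1 := hs.jump_le i hi hiN
      have h2 := hwB _ (hF.mem_Icc hiN.le)
      have h3 : |(s (i + 1) - s i) * w (x i)| ≤ m * B := by
        rw [abs_mul]
        gcongr
      linarith [le_abs_self ((s (i + 1) - s i) * w (x i))]
  -- Index i of `I` and `E` stands for face i + 1, over [x i, x (i + 1)]; `l i` and `r i` are the
  -- shares of corner i for the faces to its left and right.
  have key := sum_faces_le hF.pos (I := fun i => -(∫ y in (x i)..(x (i + 1)), w y * a y))
    (E := fun i => G * (∫ y in (x i)..(x (i + 1)), (p y - s (i + 1)) ^ 2)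
        + (G + L) * m * (x (i + 1) - x i))
    (l := fun i => (1 / 2) * (s (i + 1) - s i) * w (x i) + v i * (p (x i) - (s i + s (i + 1)) / 2))
    (r := fun i => (1 / 2) * (s (i + 1) - s i) * w (x i)
      - v (i + 1) * (p (x i) - (s i + s (i + 1)) / 2))
    (M := m * B / 2) (fun i hi hiN => ?_) (hend 0 hF.pos) (hend (N - 1) (by have := hF.pos; omega))
    (fun h2 => ?_) (fun h2 => ?_) (by positivity)
  · have e1 : ∑ i ∈ Finset.range N, (G * (∫ y in (x i)..(x (i + 1)), (p y - s (i + 1)) ^ 2)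
        + (G + L) * m * (x (i + 1) - x i))
        = G * ∑ i ∈ Finset.range N, (∫ y in (x i)..(x (i + 1)), (p y - s (i + 1)) ^ 2)
          + (G + L) * m := by
      rw [Finset.sum_add_distrib, ← Finset.mul_sum, ← Finset.mul_sum, Finset.sum_range_sub, hF.last,
        hF.first]
      ring
    rw [e1, Finset.sum_neg_distrib, hadj] at key
    have e2 : ∑ i ∈ Finset.Ico 1 N, ((s (i + 1) - s i) * w (x i)
        - (v (i + 1) - v i) * (p (x i) - (s i + s (i + 1)) / 2))
        = ∑ i ∈ Finset.Ico 1 N, ((1 / 2) * (s (i + 1) - s i) * w (x i)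
          + v i * (p (x i) - (s i + s (i + 1)) / 2) + ((1 / 2) * (s (i + 1) - s i) * w (x i)
          - v (i + 1) * (p (x i) - (s i + s (i + 1)) / 2))) :=
      Finset.sum_congr rfl fun i _ => by ring
    rw [e2]
    linarith
  · -- an inner face
    have hlt := hF.strict i (by omega)
    have hS := hsub i (by omega)
    obtain ⟨ξ, hξ, hΔ⟩ := exists_faceDelta_eq hW (s := s) (i := i + 1)
      ((hs.adjacent i hi (by omega)).trichotomy (hs.adjacent (i + 1) (by omega) hiN))
    simp only [Nat.add_sub_cancel] at hξ hΔ
    have j1 := hs.jump_le i hi (by omega)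
    have j2 := hs.jump_le (i + 1) (by omega) hiN
    have hξR : |ξ| ≤ R := abs_le.2 (hξ (-R) R (abs_le.1 (hs.abs_le i hi (by omega)))
      (abs_le.1 (hs.abs_le (i + 1) (by omega) (by omega)))
      (abs_le.1 (hs.abs_le (i + 1 + 1) (by omega) (by omega))))
    have hξm : |ξ - s (i + 1)| ≤ m := by
      have a1 := abs_le.1 j1
      have a2 := abs_le.1 j2
      have := hξ (s (i + 1) - m) (s (i + 1) + m) ⟨by linarith, by linarith⟩
        ⟨by linarith, by linarith⟩ ⟨by linarith, by linarith⟩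
      exact abs_le.2 ⟨by linarith [this.1], by linarith [this.2]⟩
    have hsR := hs.abs_le (i + 1) (by omega) (by omega)
    have hface := inner_face_bound (p := p) (a := a) (w := w)
      (q := fun y => Real.sqrt (1 + p y ^ 2) * iteratedDeriv 2 W (p y))
      (s₀ := s (i + 1)) (d := s (i + 1) - s i) (d' := s (i + 1 + 1) - s (i + 1))
      (Q := Real.sqrt (1 + s (i + 1) ^ 2) * iteratedDeriv 2 W ξ) (c := c) (K := K) (B := B) (L := L)
      (m := m) hlt (fun y hy => (hp y (hS hy)).mono hS) (ha.mono hS) (hw.mono hS)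
      (fun y hy => hwq y (hS hy)) (fun y hy => haB y (hS hy))
      (fun y hy z hz => hL y (hS hy) z (hS hz)) hc (hcK 0 _ ξ (by
        rw [abs_zero]; exact (abs_nonneg _).trans hξR) hsR hξR).1 hL0
      (fun y hy => (hcK (p y) _ ξ (hpR y (hS hy)) hsR hξR).2.trans (by gcongr)) hm0 hm j1 j2
    have hvi : v (i + 1) = Real.sqrt (1 + s (i + 1) ^ 2) * iteratedDeriv 2 W ξ
        * ((s (i + 1) - s i + (s (i + 1 + 1) - s (i + 1))) / 2) / (x (i + 1) - x i) := by
      rw [hv, faceVelocity, if_pos ⟨by omega, by omega⟩, hΔ, Nat.add_sub_cancel]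
      ring
    rw [← hvi] at hface
    refine le_trans (le_of_eq ?_) hface
    ring
  · have := hside 1 le_rfl (by omega)
    simp only [hv, faceVelocity_one, zero_mul, add_zero]
    exact this
  · have := hside (N - 1) (by omega) (by omega)
    simp only [hv]
    rw [Nat.sub_add_cancel hF.pos, faceVelocity_last, zero_mul, sub_zero]
    rwa [Nat.sub_add_cancel hF.pos] at this

end RateBound

/-! ### The energy identity and the differential inequality -/

namespace Flow

variable {W : ℝ → ℝ} {S J : Set ℝ} (U : Flow W S J) {u : ℝ → ℝ → ℝ}

/-- The rate of change of the energy within an epoch. -/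
lemma hasDerivWithinAt_upsilon
    (hu : ContDiffOn ℝ 2 (fun p : ℝ × ℝ => u p.1 p.2) (Icc (0 : ℝ) 1 ×ˢ J))
    (hJc : J.OrdConnected) (hJ0 : IsLeast J 0) (hJ : UniqueDiffOn ℝ J)
    (h0 : ∀ t ∈ J, u 0 t = 0) (h1 : ∀ t ∈ J, u 1 t = 0) {k : ℕ} (hk : k ≤ U.K) {t : ℝ}
    (ht : t ∈ U.epoch k) :
    HasDerivWithinAt (upsilon u U.toFun)
      (-(∫ x in (0 : ℝ)..1, timeDeriv J u x t * spaceDeriv (spaceDeriv u) x t)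
        + ∑ i ∈ Finset.Ico 1 (U.N k), ((U.slope k (i + 1) - U.slope k i)
            * timeDeriv J u (U.corner k t i) t
          - (faceVelocity W (U.N k) (U.slope k) (U.corner k t) (i + 1)
              - faceVelocity W (U.N k) (U.slope k) (U.corner k t) i)
            * (spaceDeriv u (U.corner k t i) t - (U.slope k i + U.slope k (i + 1)) / 2)))
      (U.epoch k) t := by
  have hu1 : ContDiffOn ℝ 1 (fun p : ℝ × ℝ => u p.1 p.2) (Icc (0 : ℝ) 1 ×ˢ J) :=
    hu.of_le (by norm_num)
  have hx : ContDiffOn ℝ 1 (fun p : ℝ × ℝ => spaceDeriv u p.1 p.2) (Icc (0 : ℝ) 1 ×ˢ J) :=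
    contDiffOn_spaceDeriv hJ (n := 1) (hu.of_le (by norm_num))
  have hF : ∀ r ∈ U.epoch k, _ := fun r hr => U.hasFaces k hk r hr
  have hform : ∀ r ∈ U.epoch k, upsilon u U.toFun r
      = (1 / 2) * (∫ y in (0 : ℝ)..1, spaceDeriv u y r ^ 2)
        + ∑ i ∈ Finset.Ico 1 (U.N k), (U.slope k (i + 1) - U.slope k i) * u (U.corner k r i) r
        + (1 / 2) * U.slope k (U.N k) ^ 2
        - (1 / 2) * ∑ i ∈ Finset.Ico 1 (U.N k),
            (U.slope k (i + 1) ^ 2 - U.slope k i ^ 2) * U.corner k r i := fun r hr =>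
    (hF r hr).half_integral_eq (g := fun y => u y r) (p := fun y => spaceDeriv u y r)
      (continuousOn_slice hx.continuousOn hr.1)
      (fun y hy => hasDerivWithinAt_spaceDeriv hu1 hy hr.1) (h0 r hr.1) (h1 r hr.1)
  have hc : ∀ i ∈ Finset.Ico 1 (U.N k), HasDerivWithinAt (fun r => U.corner k r i)
      (-(faceVelocity W (U.N k) (U.slope k) (U.corner k t) (i + 1)
        - faceVelocity W (U.N k) (U.slope k) (U.corner k t) i)
        / (U.slope k (i + 1) - U.slope k i)) (U.epoch k) t := fun i hi =>
    U.corner_deriv k hk t ht i (Finset.mem_Ico.1 hi).1 (Finset.mem_Ico.1 hi).2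
  have d1 := (hasDerivWithinAt_half_integral_sq hu hJc hJ0 hJ h0 h1 ht.1).mono (U.epoch_subset k)
  have d2 := HasDerivWithinAt.fun_sum fun i hi =>
    (hasDerivWithinAt_comp_moving hJ hu1 (hc i hi) (U.epoch_subset k)
      (fun r hr => (hF r hr).mem_Icc (Finset.mem_Ico.1 hi).2.le) ht).const_mul
      (U.slope k (i + 1) - U.slope k i)
  have d3 := HasDerivWithinAt.fun_sum fun i hi =>
    (hc i hi).const_mul (U.slope k (i + 1) ^ 2 - U.slope k i ^ 2)
  refine ((((d1.add d2).add_const _).sub (d3.const_mul (1 / 2))).congr_of_mem hform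
    ht).congr_deriv ?_
  -- The motion of corner i contributes (s_{i+1} - s_i) x_i' times u_x minus the mean slope, and the
  -- law of motion makes the first product -(v_{i+1} - v_i).
  rw [add_sub_assoc, Finset.mul_sum, ← Finset.sum_sub_distrib]
  congr 1
  refine Finset.sum_congr rfl fun i hi => ?_
  have hne := sub_ne_zero.2
    ((hF t ht).slope_ne i (Finset.mem_Ico.1 hi).1 (Finset.mem_Ico.1 hi).2).symm
  field_simp
  ring

end Flow

/-- On compact time intervals the energy satisfies a linear differential inequality, with constants
that do not depend on the flow. -/
lemma exists_rate_bound {W : ℝ → ℝ} (hW : ContDiff ℝ 3 W) (hWconv : ∀ p, 0 < iteratedDeriv 2 W p)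
    {J : Set ℝ} (hJc : J.OrdConnected) (hJ0 : IsLeast J 0) (hJ : UniqueDiffOn ℝ J)
    {u : ℝ → ℝ → ℝ} (hu : IsClassicalSolution W J u) {T : ℝ} (hT : T ∈ J) :
    ∃ C R, 0 ≤ C ∧ ∀ m : ℝ, 0 < m → m ≤ 1 → ∀ (S : Set ℝ) (U : Flow W S J),
      InitiallyClose u U m → ∀ k, k ≤ U.K → ∀ t ∈ U.epoch k, t ≤ T →
      ControlledSlopes S m R (U.N k) (U.slope k) ∧
      ∃ D, HasDerivWithinAt (upsilon u U.toFun) D (U.epoch k) t ∧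
        D ≤ C * upsilon u U.toFun t + C * m := by
  have hu2 : ContDiffOn ℝ 2 (fun p : ℝ × ℝ => u p.1 p.2) (Icc (0 : ℝ) 1 ×ˢ J) :=
    hu.contDiffOn.of_le (by norm_num)
  have hx : ContDiffOn ℝ 2 (fun p : ℝ × ℝ => spaceDeriv u p.1 p.2) (Icc (0 : ℝ) 1 ×ˢ J) :=
    contDiffOn_spaceDeriv hJ (n := 2) (hu.contDiffOn.of_le (by norm_num))
  have hxx : ContDiffOn ℝ 1 (fun p : ℝ × ℝ => spaceDeriv (spaceDeriv u) p.1 p.2)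
      (Icc (0 : ℝ) 1 ×ˢ J) := contDiffOn_spaceDeriv hJ (n := 1) (hx.of_le (by norm_num))
  have ht : ContDiffOn ℝ 1 (fun p : ℝ × ℝ => timeDeriv J u p.1 p.2) (Icc (0 : ℝ) 1 ×ˢ J) :=
    contDiffOn_timeDeriv hJ (n := 1) (hu2.of_le (by norm_num))
  have htx : ContDiffOn ℝ 0 (fun p : ℝ × ℝ => spaceDeriv (timeDeriv J u) p.1 p.2)
      (Icc (0 : ℝ) 1 ×ˢ J) := contDiffOn_spaceDeriv hJ (n := 0) (ht.of_le (by norm_num))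
  have hx1 := hx.of_le (m := 1) (by norm_num)
  obtain ⟨B₁, hB₁0, hB₁⟩ := exists_bound_on_strip hJc hJ0.1 hT hx.continuousOn
  obtain ⟨B₂, hB₂0, hB₂⟩ := exists_bound_on_strip hJc hJ0.1 hT hxx.continuousOn
  obtain ⟨B₃, hB₃0, hB₃⟩ := exists_bound_on_strip hJc hJ0.1 hT ht.continuousOn
  obtain ⟨L, hL0, hL⟩ := exists_bound_on_strip hJc hJ0.1 hT htx.continuousOn
  -- The radius B₁ + 1 covers u_x and also all slopes of the flow: these start within m ≤ 1 of u_x,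
  -- and the bound propagates.
  obtain ⟨c, K, hc, hK, hcK⟩ := exists_coefficient_bounds hW hWconv
    (show 0 ≤ B₁ + 1 by positivity)
  set B := max B₂ B₃ with hB
  have hB0 : 0 ≤ B := hB₂0.trans (le_max_left _ _)
  set G := K ^ 2 * B ^ 2 / (2 * c) with hG
  have hG0 : 0 ≤ G := by positivity
  -- The face integrals sum to 2Υ, which requires 2G; the m-term requires G + L + B. One constant
  -- serves both.
  refine ⟨2 * G + L + B, B₁ + 1, by positivity, fun m hm0 hm S U hU k hk t htk htT => ?_⟩
  have htJ := htk.1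
  have ht0 : t ∈ Icc 0 T := ⟨hJ0.2 htJ, htT⟩
  have hW2 : ContDiff ℝ 2 W := hW.of_le (by norm_num)
  have hs0 := U.controlledSlopes_zero hJ0.1 hU fun y hy => hB₁ y hy 0 ⟨le_rfl, hJ0.2 hT⟩
  have hs1 : ControlledSlopes S m (B₁ + 1) (U.N 0) (U.slope 0) :=
    ⟨hs0.adjacent, hs0.jump_le, fun i hi hiN => (hs0.abs_le i hi hiN).trans (by linarith)⟩
  have hek : U.eventTime k ∈ J := hJc.out hJ0.1 htJ ⟨U.eventTime_nonneg hk, htk.2.1⟩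
  have hs := U.controlledSlopes hW2 hWconv hJc hJ0.1 (by positivity) hs1 hk hek
  have hF := U.hasFaces k hk t htk
  refine ⟨hs, _, U.hasDerivWithinAt_upsilon hu2 hJc hJ0 hJ hu.boundary_left hu.boundary_right hk htk,
    ?_⟩
  have hrate := rate_le hW2 hF hs hm0.le hm (p := fun y => spaceDeriv u y t)
    (a := fun y => spaceDeriv (spaceDeriv u) y t) (w := fun y => timeDeriv J u y t)
    (fun y hy => hasDerivWithinAt_spaceDeriv hx1 hy htJ)
    (continuousOn_slice hxx.continuousOn htJ) (continuousOn_slice ht.continuousOn htJ)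
    (fun y hy => ?_) (B := B) (L := L) (c := c) (K := K)
    (fun y hy => (hB₂ y hy t ht0).trans (le_max_left _ _))
    (fun y hy => (hB₃ y hy t ht0).trans (le_max_right _ _)) (fun y hy z hz => ?_)
    (fun y hy => (hB₁ y hy t ht0).trans (by linarith)) hL0 hc hK hcK
  · have hups : upsilon u U.toFun t = _ := hF.half_integral_eq_sum
      (p := fun y => spaceDeriv u y t) (continuousOn_slice hx.continuousOn htJ)
    have hnn : 0 ≤ upsilon u U.toFun t := by
      unfold upsilon
      exact mul_nonneg (by norm_num)
        (intervalIntegral.integral_nonneg zero_le_one fun y _ => by positivity)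
    refine hrate.trans ?_
    rw [show (∑ i ∈ Finset.range (U.N k), ∫ y in (U.corner k t i)..(U.corner k t (i + 1)),
      (spaceDeriv u y t - U.slope k (i + 1)) ^ 2) = 2 * upsilon u U.toFun t by rw [hups]; ring,
      ← hG]
    nlinarith [mul_nonneg (add_nonneg hL0 hB0) hnn, mul_nonneg hG0 hm0.le]
  · have h1 := hu.equation y hy t htJ
    rw [div_eq_iff (by positivity)] at h1
    rw [h1]
    ring
  · exact (convex_Icc 0 1).norm_image_sub_le_of_norm_hasDerivWithin_le
      (fun y hy => hasDerivWithinAt_spaceDeriv ht hy htJ) (fun y hy => hL y hy t ht0) hz hy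

/-! ### Integration away from the corners, and the Poincaré inequality -/

section AlmostEverywhere

variable {S : Set ℝ} {f : ℝ → ℝ} {N : ℕ} {s x : ℕ → ℝ}

lemma finite_corners (X : ℕ → ℝ) (N : ℕ) : (X '' {i | i ≤ N}).Finite :=
  (Set.finite_le_nat N).image X

lemma exists_mem_Ioo_of_notMem {X : ℕ → ℝ} {N : ℕ} (h0 : X 0 = 0) (hN : X N = 1) {y : ℝ}
    (hy : y ∉ X '' {i | i ≤ N}) (hy1 : y ∈ Ioc (0 : ℝ) 1) :
    ∃ i, i < N ∧ y ∈ Ioo (X i) (X (i + 1)) := by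
  obtain ⟨i, hi, h1, h2⟩ := exists_mem_Ioc_of_mem_Ioc (h0.symm ▸ hy1.1) (hN.symm ▸ hy1.2)
  exact ⟨i, hi, h1, lt_of_le_of_ne h2 fun e => hy ⟨i + 1, hi, e.symm⟩⟩

lemma ae_exists_mem_Ioo {X : ℕ → ℝ} {N : ℕ} (h0 : X 0 = 0) (hN : X N = 1) :
    ∀ᵐ y : ℝ, y ∈ uIoc (0 : ℝ) 1 → ∃ i, i < N ∧ y ∈ Ioo (X i) (X (i + 1)) := by
  filter_upwards [(finite_corners X N).countable.ae_notMem volume] with y hy hy1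
  rw [uIoc_of_le zero_le_one] at hy1
  exact exists_mem_Ioo_of_notMem h0 hN hy hy1

lemma HasFaces.mem_Icc_of_mem_Ioo (hF : HasFaces S f N s x) {i : ℕ} (hi : i < N) {y : ℝ}
    (hy : y ∈ Ioo (x i) (x (i + 1))) : y ∈ Icc (0 : ℝ) 1 :=
  ⟨(hF.mem_Icc hi.le).1.trans hy.1.le, hy.2.le.trans (hF.mem_Icc hi).2⟩

lemma HasFaces.intervalIntegrable (hF : HasFaces S f N s x) {h : ℝ → ℝ}
    (hh : ∀ i, i < N → ∃ g, ContinuousOn g (Icc 0 1) ∧ ∀ y ∈ Ioo (x i) (x (i + 1)), h y = g y) :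
    IntervalIntegrable h volume 0 1 := by
  rw [← hF.first, ← hF.last]
  refine IntervalIntegrable.trans_iterate fun i hi => ?_
  obtain ⟨g, hg, hgh⟩ := hh i hi
  refine (hF.intervalIntegrable_face hg hi).congr_ae
    ((ae_restrict_iff' measurableSet_uIoc).2 ?_)
  filter_upwards [(finite_corners x N).countable.ae_notMem volume] with y hy hy1
  rw [uIoc_of_le (hF.strict i hi).le] at hy1
  exact (hgh y ⟨hy1.1, lt_of_le_of_ne hy1.2 fun e => hy ⟨i + 1, hi, e.symm⟩⟩).symm

/-- Nonnegativity of the variance on an interval of length one. -/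
lemma sq_integral_le {g : ℝ → ℝ} (hg : IntervalIntegrable g volume 0 1)
    (hg2 : IntervalIntegrable (fun y => g y ^ 2) volume 0 1) :
    (∫ y in (0 : ℝ)..1, g y) ^ 2 ≤ ∫ y in (0 : ℝ)..1, g y ^ 2 := by
  set M := ∫ y in (0 : ℝ)..1, g y with hM
  have h1 : 0 ≤ ∫ y in (0 : ℝ)..1, (g y - M) ^ 2 :=
    intervalIntegral.integral_nonneg zero_le_one fun y _ => sq_nonneg _
  have h2 : ∫ y in (0 : ℝ)..1, (g y - M) ^ 2
      = (∫ y in (0 : ℝ)..1, g y ^ 2) - 2 * M * M + M ^ 2 := by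
    have e : ∀ y, (g y - M) ^ 2 = g y ^ 2 - 2 * M * g y + M ^ 2 := fun y => by ring
    simp only [e]
    rw [intervalIntegral.integral_add (hg2.sub (hg.const_mul _)) intervalIntegrable_const,
      intervalIntegral.integral_sub hg2 (hg.const_mul _), intervalIntegral.integral_const_mul,
      intervalIntegral.integral_const, ← hM]
    simp
  nlinarith

/-- The Poincaré inequality for the difference of a smooth and a piecewise linear function. -/
lemma HasFaces.h1Norm_le (hF : HasFaces S f N s x) (hf : ContinuousOn f (Icc 0 1))
    (hf0 : f 0 = 0) {g p : ℝ → ℝ} (hp : ContinuousOn p (Icc 0 1))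
    (hg : ∀ y ∈ Icc (0 : ℝ) 1, HasDerivWithinAt g (p y) (Icc 0 1) y) (hg0 : g 0 = 0) :
    h1Norm (fun y => g y - f y)
      ≤ Real.sqrt (2 * ∫ y in (0 : ℝ)..1, |p y - derivWithin f (Icc 0 1) y| ^ 2) := by
  have hgc : ContinuousOn g (Icc 0 1) := fun y hy => (hg y hy).continuousWithinAt
  have hd : ∀ i, i < N → ∀ y ∈ Ioo (x i) (x (i + 1)),
      HasDerivAt (fun y => g y - f y) (p y - derivWithin f (Icc 0 1) y) y := fun i hi y hy => by
    have hsub : Icc (x i) (x (i + 1)) ⊆ Icc 0 1 :=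
      Icc_subset_Icc (hF.mem_Icc hi.le).1 (hF.mem_Icc hi).2
    rw [hF.derivWithin_eq hi hy]
    exact ((hg y (hF.mem_Icc_of_mem_Ioo hi hy)).hasDerivAt
      (Filter.mem_of_superset (Icc_mem_nhds hy.1 hy.2) hsub)).sub (hF.hasDerivAt hi hy)
  have i1 : IntervalIntegrable (fun y => p y - derivWithin f (Icc 0 1) y) volume 0 1 :=
    hF.intervalIntegrable fun i hi => ⟨fun y => p y - s (i + 1), by fun_prop,
      fun y hy => by rw [hF.derivWithin_eq hi hy]⟩
  have i2 : IntervalIntegrable (fun y => |p y - derivWithin f (Icc 0 1) y| ^ 2) volume 0 1 :=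
    hF.intervalIntegrable fun i hi => ⟨fun y => |p y - s (i + 1)| ^ 2, by fun_prop,
      fun y hy => by rw [hF.derivWithin_eq hi hy]⟩
  set A := ∫ y in (0 : ℝ)..1, |p y - derivWithin f (Icc 0 1) y| ^ 2 with hA
  have hAe : ∫ y in (0 : ℝ)..1, derivWithin (fun y => g y - f y) (Icc 0 1) y ^ 2 = A := by
    refine intervalIntegral.integral_congr_ae ?_
    filter_upwards [ae_exists_mem_Ioo hF.first hF.last] with y hy hy1
    obtain ⟨i, hi, hyi⟩ := hy hy1
    rw [(hd i hi y hyi).hasDerivWithinAt.derivWithin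
      (uniqueDiffOn_Icc zero_lt_one y (hF.mem_Icc_of_mem_Ioo hi hyi)), sq_abs]
  have hw : ∀ z ∈ Icc (0 : ℝ) 1, (g z - f z) ^ 2 ≤ A := fun z hz => by
    have hsub : Icc 0 z ⊆ Icc (0 : ℝ) 1 := Icc_subset_Icc_right hz.2
    -- The fundamental theorem of calculus tolerates the finitely many corners because the
    -- difference is continuous.
    have e := integral_eq_of_hasDerivAt_off_countable (fun y => g y - f y)
      (fun y => p y - derivWithin f (Icc 0 1) y) (a := 0) (b := z)
      (finite_corners x N).countable
      (by rw [uIcc_of_le hz.1]; exact (hgc.sub hf).mono hsub)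
      (fun y hy => by
        rw [min_eq_left hz.1, max_eq_right hz.1] at hy
        obtain ⟨i, hi, hyi⟩ := exists_mem_Ioo_of_notMem hF.first hF.last hy.2
          ⟨hy.1.1, hy.1.2.le.trans hz.2⟩
        exact hd i hi y hyi)
      (i1.mono_set (by rw [uIcc_of_le hz.1, uIcc_of_le zero_le_one]; exact hsub))
    simp only [hg0, hf0, sub_self, sub_zero] at e
    have h1 : |g z - f z| ≤ ∫ y in (0 : ℝ)..1, |p y - derivWithin f (Icc 0 1) y| := by
      rw [← e]
      refine (intervalIntegral.abs_integral_le_integral_abs hz.1).trans ?_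
      exact intervalIntegral.integral_mono_interval le_rfl hz.1 hz.2
        (ae_of_all _ fun y => abs_nonneg _) i1.abs
    rw [← sq_abs]
    exact (pow_le_pow_left₀ (abs_nonneg _) h1 2).trans (sq_integral_le i1.abs i2)
  have hw' : ∫ y in (0 : ℝ)..1, (g y - f y) ^ 2 ≤ A := by
    have hc : ContinuousOn (fun y => (g y - f y) ^ 2) (Icc 0 1) := (hgc.sub hf).pow 2
    have := intervalIntegral.integral_mono_on (zero_le_one (α := ℝ))
      (hc.intervalIntegrable_of_Icc zero_le_one)
      (intervalIntegrable_const (c := A) (μ := volume)) hw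
    simpa using this
  unfold h1Norm
  rw [hAe]
  exact Real.sqrt_le_sqrt (by linarith)

end AlmostEverywhere

/-! ### Continuity through event times, Grönwall and the choice of Λ -/

namespace Flow

variable {W : ℝ → ℝ} {S J : Set ℝ} (U : Flow W S J) {u : ℝ → ℝ → ℝ}

lemma epoch_mem_nhdsWithin {k : ℕ} {t : ℝ} (ht : t ∈ U.epoch k) {D : Set ℝ} (hD : D ⊆ J)
    (h : ∀ᶠ r in 𝓝[D] t, U.eventTime k ≤ r) : U.epoch k ∈ 𝓝[D] t := by
  have h2 : ∀ᶠ r in 𝓝[D] t, k < U.K → r < U.eventTime (k + 1) := by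
    by_cases hk : k < U.K
    · filter_upwards [mem_nhdsWithin_of_mem_nhds (Iio_mem_nhds (ht.2.2 hk))] with r hr _ using hr
    · exact Eventually.of_forall fun r h => absurd h hk
  filter_upwards [h, h2, self_mem_nhdsWithin] with r h1 h2 h3 using ⟨hD h3, h1, h2⟩

lemma epoch_mem_nhdsWithin_Ici {k : ℕ} {t : ℝ} (ht : t ∈ U.epoch k) :
    U.epoch k ∈ 𝓝[J ∩ Ici t] t :=
  U.epoch_mem_nhdsWithin ht inter_subset_left <| by
    filter_upwards [self_mem_nhdsWithin] with r hr using ht.2.1.trans hr.2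

lemma epoch_mem_nhdsWithin_of_ne (hJ0 : IsLeast J 0) {k : ℕ} {t : ℝ} (ht : t ∈ U.epoch k)
    (hne : 1 ≤ k → t ≠ U.eventTime k) : U.epoch k ∈ 𝓝[J] t := by
  refine U.epoch_mem_nhdsWithin ht subset_rfl ?_
  rcases Nat.eq_zero_or_pos k with rfl | hk
  · filter_upwards [self_mem_nhdsWithin] with r hr
    rw [U.eventTime_zero]
    exact hJ0.2 hr
  · filter_upwards [mem_nhdsWithin_of_mem_nhds
      (Ioi_mem_nhds (lt_of_le_of_ne ht.2.1 (hne hk).symm))] with r hr using (mem_Ioi.1 hr).le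

/-- The energy is continuous from the left at event times. -/
lemma tendsto_upsilon_nhdsLT (hJ : J.OrdConnected) (hJ0 : IsLeast J 0)
    (hx : ContinuousOn (fun p : ℝ × ℝ => spaceDeriv u p.1 p.2) (Icc (0 : ℝ) 1 ×ˢ J))
    {k : ℕ} (hk : k < U.K) (hT : U.eventTime (k + 1) ∈ J) {R : ℝ}
    (hR : ∀ i, 1 ≤ i → i ≤ U.N k → |U.slope k i| ≤ R) :
    Tendsto (upsilon u U.toFun) (𝓝[<] (U.eventTime (k + 1)))
      (𝓝 (upsilon u U.toFun (U.eventTime (k + 1)))) := by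
  have hM := U.cornerMotion hJ hJ0.1 hk hT
  have he := U.epoch_eq_Ico hJ hJ0.1 hk hT
  obtain ⟨X, hX⟩ := hM.exists_tendsto
  have hIco : ∀ᶠ t in 𝓝[<] (U.eventTime (k + 1)), t ∈ U.epoch k :=
    he ▸ Filter.mem_of_superset (Ioo_mem_nhdsLT hM.lt) Ioo_subset_Ico_self
  have hX0 : X 0 = 0 := tendsto_nhds_unique (hX 0 (Nat.zero_le _))
    (tendsto_const_nhds.congr' (hIco.mono fun t ht => (hM.first t (he ▸ ht)).symm))
  have hXN : X (U.N k) = 1 := tendsto_nhds_unique (hX _ le_rfl)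
    (tendsto_const_nhds.congr' (hIco.mono fun t ht => (hM.last t (he ▸ ht)).symm))
  have h01 : ∀ j, j ≤ U.N k → X j ∈ Icc (0 : ℝ) 1 := fun j hj => by
    refine isClosed_Icc.mem_of_tendsto (hX j hj) (hIco.mono fun t ht => ?_)
    exact hM.mem_Icc (he ▸ ht) hj
  obtain ⟨B, hB0, hB⟩ := exists_bound_on_strip hJ hJ0.1 hT hx
  unfold upsilon
  refine Tendsto.const_mul _ (intervalIntegral.tendsto_integral_filter_of_dominated_convergence
    (fun _ => (B + R) ^ 2) ?_ ?_ intervalIntegrable_const ?_)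
  · filter_upwards [hIco] with t ht
    have hF := U.hasFaces k hk.le t ht
    have : IntervalIntegrable (fun y => |spaceDeriv u y t - spaceDeriv U.toFun y t| ^ 2)
        volume 0 1 := hF.intervalIntegrable fun i hi =>
      ⟨fun y => |spaceDeriv u y t - U.slope k (i + 1)| ^ 2,
        ((continuousOn_slice hx ht.1).sub continuousOn_const).abs.pow 2,
        fun y hy => by rw [show spaceDeriv U.toFun y t = _ from hF.derivWithin_eq hi hy]⟩
    rw [uIoc_of_le zero_le_one]
    exact this.aestronglyMeasurable
  · filter_upwards [hIco] with t ht
    have hF := U.hasFaces k hk.le t ht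
    filter_upwards [ae_exists_mem_Ioo hF.first hF.last] with y hy hy1
    obtain ⟨i, hi, hyi⟩ := hy hy1
    have h1 : spaceDeriv U.toFun y t = _ := hF.derivWithin_eq hi hyi
    have h2 := hB y (hF.mem_Icc_of_mem_Ioo hi hyi) t ⟨hJ0.2 ht.1, (ht.2.2 hk).le⟩
    have h3 := hR (i + 1) (by omega) hi
    rw [h1, norm_pow, Real.norm_eq_abs, abs_abs]
    gcongr
    exact (abs_sub _ _).trans (add_le_add h2 h3)
  -- Almost every y is interior to a face that does not collapse. Near the event time y stays inside
  -- that face, so the slope of the flow at y is already the limiting one.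
  · filter_upwards [ae_exists_mem_Ioo hX0 hXN] with y hy hy1
    obtain ⟨i, hi, hyi⟩ := hy hy1
    have hy01 : y ∈ Icc (0 : ℝ) 1 :=
      ⟨(h01 i hi.le).1.trans hyi.1.le, hyi.2.le.trans (h01 (i + 1) hi).2⟩
    have e1 : spaceDeriv U.toFun y (U.eventTime (k + 1)) = U.slope k (i + 1) := by
      have h1 : HasDerivAt (fun z => U.toFun y (U.eventTime (k + 1))
          + U.slope k (i + 1) * (z - y)) (U.slope k (i + 1)) y := by
        simpa using (((hasDerivAt_id y).sub_const y).const_mul (U.slope k (i + 1))).const_add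
          (U.toFun y (U.eventTime (k + 1)))
      refine (h1.congr_of_eventuallyEq ?_).hasDerivWithinAt.derivWithin
        (uniqueDiffOn_Icc zero_lt_one y hy01)
      filter_upwards [Ioo_mem_nhds hyi.1 hyi.2] with z hz
      rw [← U.sub_eq_of_tendsto hJ hJ0.1 hk hT hX hi hz hyi]
      ring
    have e2 : ∀ᶠ t in 𝓝[<] (U.eventTime (k + 1)), U.slope k (i + 1) = spaceDeriv U.toFun y t := by
      filter_upwards [hIco, (hX i hi.le).eventually_lt_const hyi.1,
        (hX (i + 1) hi).eventually_const_lt hyi.2] with t ht h1 h2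
      exact ((U.hasFaces k hk.le t ht).derivWithin_eq hi ⟨h1, h2⟩).symm
    rw [e1]
    have e3 : Tendsto (fun t => spaceDeriv u y t) (𝓝[<] (U.eventTime (k + 1)))
        (𝓝 (spaceDeriv u y (U.eventTime (k + 1)))) :=
      (continuousOn_time_slice hx hy01 _ hT).mono_left
        (nhdsWithin_le_iff.2 (hIco.mono fun t ht => ht.1))
    exact ((e3.sub (tendsto_const_nhds.congr' e2)).abs).pow 2

/-- The energy is continuous. -/
lemma continuousOn_upsilon (hJ : J.OrdConnected) (hJ0 : IsLeast J 0)
    (hx : ContinuousOn (fun p : ℝ × ℝ => spaceDeriv u p.1 p.2) (Icc (0 : ℝ) 1 ×ˢ J))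
    (hepoch : ∀ k, k ≤ U.K → ∀ t ∈ U.epoch k,
      ContinuousWithinAt (upsilon u U.toFun) (U.epoch k) t ∧
      ∃ R, ∀ i, 1 ≤ i → i ≤ U.N k → |U.slope k i| ≤ R) :
    ContinuousOn (upsilon u U.toFun) J := by
  intro t ht
  obtain ⟨k, hk, htk⟩ := U.exists_mem_epoch ht (hJ0.2 ht)
  by_cases hne : 1 ≤ k → t ≠ U.eventTime k
  · exact (hepoch k hk t htk).1.mono_of_mem_nhdsWithin (U.epoch_mem_nhdsWithin_of_ne hJ0 htk hne)
  push Not at hne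
  obtain ⟨hk1, rfl⟩ := hne
  obtain ⟨k, rfl⟩ := Nat.exists_eq_add_of_le' hk1
  have hkt : U.eventTime k ∈ J := hJ.out hJ0.1 ht
    ⟨U.eventTime_nonneg (by omega), U.eventTime_mono (Nat.le_succ k) hk⟩
  obtain ⟨R, hR⟩ := (hepoch k (by omega) _ (U.mem_epoch_start hkt)).2
  have h1 := U.tendsto_upsilon_nhdsLT hJ hJ0 hx hk ht hR
  have h2 := (hepoch (k + 1) hk _ htk).1.mono_of_mem_nhdsWithin (U.epoch_mem_nhdsWithin_Ici htk)
  have h3 : ContinuousWithinAt (upsilon u U.toFun) (Iio (U.eventTime (k + 1)))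
    (U.eventTime (k + 1)) := h1
  -- At an event time, left continuity comes from the limit of the old epoch and right continuity
  -- from the new epoch.
  refine (h3.union h2).mono fun r hr => ?_
  rcases lt_or_ge r (U.eventTime (k + 1)) with h | h
  · exact .inl h
  · exact .inr ⟨hr, h⟩

lemma upsilon_zero_le (hJ0 : (0 : ℝ) ∈ J) {m : ℝ} (hU : InitiallyClose u U m) :
    upsilon u U.toFun 0 ≤ m ^ 2 / 2 := by
  have h0 : (0 : ℝ) ∈ U.epoch 0 := by
    have := U.mem_epoch_start (k := 0) (by rwa [U.eventTime_zero])
    rwa [U.eventTime_zero] at this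
  have hF := U.hasFaces 0 (Nat.zero_le _) 0 h0
  have h1 : ‖∫ y in (0 : ℝ)..1, |spaceDeriv u y 0 - spaceDeriv U.toFun y 0| ^ 2‖
      ≤ m ^ 2 * |1 - 0| := by
    refine intervalIntegral.norm_integral_le_of_norm_le_const_ae ?_
    filter_upwards [ae_exists_mem_Ioo hF.first hF.last] with y hy hy1
    obtain ⟨i, hi, hyi⟩ := hy hy1
    rw [norm_pow, Real.norm_eq_abs, abs_abs, abs_sub_comm]
    exact pow_le_pow_left₀ (abs_nonneg _) (hU.slope_close y (hF.mem_Icc_of_mem_Ioo hi hyi)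
      (hF.hasDerivAt hi hyi).differentiableAt.differentiableWithinAt) 2
  rw [sub_zero, abs_one, mul_one] at h1
  unfold upsilon
  linarith [(Real.le_norm_self _).trans h1]

end Flow

lemma upsilon_nonneg (u v : ℝ → ℝ → ℝ) (t : ℝ) : 0 ≤ upsilon u v t :=
  mul_nonneg (by norm_num) (intervalIntegral.integral_nonneg zero_le_one fun _ _ => by positivity)

/-- Grönwall's inequality for the energy. -/
lemma upsilon_le_of_rate {J : Set ℝ} (hJ : J.OrdConnected) (hJ0 : IsLeast J 0) {f : ℝ → ℝ}
    (hf : ContinuousOn f J) {T C m : ℝ} (hT : T ∈ J) (hC : 0 < C) (hm : 0 ≤ m)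
    (h0 : f 0 ≤ m) (hrate : ∀ t ∈ Ico 0 T, ∃ D, HasDerivWithinAt f D (J ∩ Ici t) t ∧
      D ≤ C * f t + C * m) {t : ℝ} (ht : t ∈ Icc 0 T) : f t ≤ 2 * Real.exp (C * T) * m := by
  have hsub : Icc 0 T ⊆ J := hJ.out hJ0.1 hT
  choose! D hD hDle using hrate
  have hright : ∀ r ∈ Ico 0 T, HasDerivWithinAt f (D r) (Ici r) r := fun r hr => by
    refine (hD r hr).mono_of_mem_nhdsWithin (inter_mem ?_ self_mem_nhdsWithin)
    exact Filter.mem_of_superset (Ico_mem_nhdsGE hr.2)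
      fun z hz => hsub ⟨hr.1.trans hz.1, hz.2.le⟩
  have key := le_gronwallBound_of_liminf_deriv_right_le (hf.mono hsub)
    (fun r hr b hb => (hright r hr).liminf_right_slope_le hb) h0 hDle t ht
  -- The Grönwall bound becomes m e^{Ct} + m (e^{Ct} - 1), whence the factor 2.
  rw [gronwallBound_of_K_ne_0 hC.ne', sub_zero, mul_div_cancel_left₀ _ hC.ne'] at key
  have hexp : Real.exp (C * t) ≤ Real.exp (C * T) := Real.exp_le_exp.2 (by nlinarith [ht.2])
  nlinarith

/-- Pointwise upper closed conditions with locally uniform bounds have a continuous selection. -/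
lemma exists_continuousOn_selection {J : Set ℝ} {P : ℝ → ℝ → Prop}
    (hconv : ∀ t ∈ J, Convex ℝ {c | P t c}) (hloc : ∀ t ∈ J, ∃ c, ∀ᶠ r in 𝓝[J] t, P r c) :
    ∃ Λ : ℝ → ℝ, ContinuousOn Λ J ∧ ∀ t ∈ J, P t (Λ t) := by
  classical
  -- A partition of unity glues constants that are locally admissible; convexity keeps the averages
  -- admissible.
  obtain ⟨g, hg⟩ := exists_continuous_forall_mem_convex_of_local_const (X := J)
    (t := fun t => {c | P t c}) (fun t => hconv t t.2) fun t => by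
      obtain ⟨c, hc⟩ := hloc t t.2
      exact ⟨c, preimage_coe_mem_nhds_subtype.2 hc⟩
  refine ⟨fun t => if h : t ∈ J then g ⟨t, h⟩ else 0, ?_, fun t ht => ?_⟩
  · rw [continuousOn_iff_continuous_domRestrict]
    convert g.continuous using 1
    ext t
    simp
  · simp only [ht, dif_pos]
    exact hg ⟨t, ht⟩

end Crystalline

end

/-! ### Assembly of the main theorem -/

theorem mainTheorem1
    (W : ℝ → ℝ) (hW : ContDiff ℝ 3 W) (hWconv : ∀ p, 0 < iteratedDeriv 2 W p)
    (J : Set ℝ) (hJ : J.OrdConnected) (hJ0 : IsLeast J 0) (hJnt : J.Nontrivial)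
    (u : ℝ → ℝ → ℝ) (hu : Crystalline.IsClassicalSolution W J u) :
    ∃ m₀ : ℝ, 0 < m₀ ∧
      (∃ Λ Γ : ℝ → ℝ, ContinuousOn Λ J ∧ ContinuousOn Γ J ∧
        ∀ m : ℝ, 0 < m → m ≤ m₀ →
        ∀ S : Set ℝ, (∀ a b : ℝ, (S ∩ Set.Icc a b).Finite) →
        ∀ U : Crystalline.Flow W S J, Crystalline.InitiallyClose u U m →
          ContinuousOn (Crystalline.upsilon u U.toFun) J ∧
          ∀ t ∈ J, (∀ k, 1 ≤ k → k ≤ U.K → t ≠ U.eventTime k) →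
            DifferentiableWithinAt ℝ (Crystalline.upsilon u U.toFun) J t ∧
            derivWithin (Crystalline.upsilon u U.toFun) J t
              ≤ Λ t * Crystalline.upsilon u U.toFun t + Γ t * m) ∧
      (∀ T ∈ J, ∃ C : ℝ,
        ∀ m : ℝ, 0 < m → m ≤ m₀ →
        ∀ S : Set ℝ, (∀ a b : ℝ, (S ∩ Set.Icc a b).Finite) →
        ∀ U : Crystalline.Flow W S J, Crystalline.InitiallyClose u U m →
        ∀ t ∈ Set.Icc 0 T,
          Crystalline.h1Norm (fun x => u x t - U.toFun x t) ≤ C * m ^ (1 / 2 : ℝ)) := by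
  have hJd := Crystalline.uniqueDiffOn_of_ordConnected hJ hJnt
  have hu1 : ContDiffOn ℝ 1 (fun p : ℝ × ℝ => u p.1 p.2) (Icc (0 : ℝ) 1 ×ˢ J) :=
    hu.contDiffOn.of_le (by norm_num)
  have hx : ContinuousOn (fun p : ℝ × ℝ => Crystalline.spaceDeriv u p.1 p.2)
      (Icc (0 : ℝ) 1 ×ˢ J) :=
    (Crystalline.contDiffOn_spaceDeriv hJd (n := 0) (hu1.of_le (by norm_num))).continuousOn
  have hrate := fun T (hT : T ∈ J) => Crystalline.exists_rate_bound hW hWconv hJ hJ0 hJd hu hT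
  have hcont : ∀ m : ℝ, 0 < m → m ≤ 1 → ∀ (S : Set ℝ) (U : Crystalline.Flow W S J),
      Crystalline.InitiallyClose u U m → ContinuousOn (Crystalline.upsilon u U.toFun) J := by
    intro m hm0 hm S U hU
    refine U.continuousOn_upsilon hJ hJ0 hx fun k hk t ht => ?_
    obtain ⟨C, R, -, h⟩ := hrate t ht.1
    obtain ⟨h1, D, hD, -⟩ := h m hm0 hm S U hU k hk t ht le_rfl
    exact ⟨hD.continuousWithinAt, R, h1.abs_le⟩
  refine ⟨1, one_pos, ?_, fun T hT => ?_⟩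
  -- The condition quantifies over all m, S and flows, so the selection cannot depend on them. The
  -- same coefficient multiplies Υ and m, so one function serves as both Λ and Γ.
  · obtain ⟨Λ, hΛ, hP⟩ := Crystalline.exists_continuousOn_selection (J := J)
      (P := fun t c => ∀ m : ℝ, 0 < m → m ≤ 1 → ∀ (S : Set ℝ) (U : Crystalline.Flow W S J),
        Crystalline.InitiallyClose u U m → (∀ k, 1 ≤ k → k ≤ U.K → t ≠ U.eventTime k) →
        DifferentiableWithinAt ℝ (Crystalline.upsilon u U.toFun) J t ∧
        derivWithin (Crystalline.upsilon u U.toFun) J t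
          ≤ c * Crystalline.upsilon u U.toFun t + c * m)
      (fun t _ c₁ h₁ c₂ h₂ a b ha hb hab m hm0 hm S U hU hne => by
        obtain ⟨hd, h1⟩ := h₁ m hm0 hm S U hU hne
        obtain ⟨-, h2⟩ := h₂ m hm0 hm S U hU hne
        refine ⟨hd, ?_⟩
        have h3 := add_le_add (mul_le_mul_of_nonneg_left h1 ha) (mul_le_mul_of_nonneg_left h2 hb)
        rw [← add_mul, hab, one_mul] at h3
        refine h3.trans (le_of_eq ?_)
        simp only [smul_eq_mul]
        ring)
      (fun t ht => by
        obtain ⟨T, hT, -, hTn⟩ := Crystalline.exists_Icc_mem_nhdsWithin hJ0 ht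
        obtain ⟨C, R, -, h⟩ := hrate T hT
        refine ⟨C, ?_⟩
        filter_upwards [hTn, self_mem_nhdsWithin] with r hr hrJ m hm0 hm S U hU hne
        obtain ⟨k, hk, hrk⟩ := U.exists_mem_epoch hrJ (hJ0.2 hrJ)
        obtain ⟨-, D, hD, hDle⟩ := h m hm0 hm S U hU k hk r hrk hr.2
        have hD' := hD.mono_of_mem_nhdsWithin
          (U.epoch_mem_nhdsWithin_of_ne hJ0 hrk fun hk1 => hne k hk1 hk)
        exact ⟨hD'.differentiableWithinAt, (hD'.derivWithin (hJd r hrJ)).trans_le hDle⟩)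
    exact ⟨Λ, Λ, hΛ, hΛ, fun m hm0 hm S _ U hU =>
      ⟨hcont m hm0 hm S U hU, fun t ht hne => hP t ht m hm0 hm S U hU hne⟩⟩
  · obtain ⟨C, R, hC0, h⟩ := hrate T hT
    -- The squared H¹ norm is at most 4Υ and Grönwall gives Υ ≤ 2 e^{(C+1)T} m, hence 8. Using C + 1
    -- makes the Grönwall rate positive.
    refine ⟨Real.sqrt (8 * Real.exp ((C + 1) * T)), fun m hm0 hm S _ U hU t ht => ?_⟩
    have htJ : t ∈ J := hJ.out hJ0.1 hT ht
    have hle : Crystalline.upsilon u U.toFun t ≤ 2 * Real.exp ((C + 1) * T) * m := by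
      refine Crystalline.upsilon_le_of_rate hJ hJ0 (hcont m hm0 hm S U hU) hT (by positivity)
        hm0.le ((U.upsilon_zero_le hJ0.1 hU).trans (by nlinarith)) (fun r hr => ?_) ht
      have hrJ : r ∈ J := hJ.out hJ0.1 hT ⟨hr.1, hr.2.le⟩
      obtain ⟨k, hk, hrk⟩ := U.exists_mem_epoch hrJ hr.1
      obtain ⟨-, D, hD, hDle⟩ := h m hm0 hm S U hU k hk r hrk hr.2.le
      exact ⟨D, hD.mono_of_mem_nhdsWithin (U.epoch_mem_nhdsWithin_Ici hrk),
        by nlinarith [Crystalline.upsilon_nonneg u U.toFun r]⟩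
    obtain ⟨k, hk, htk⟩ := U.exists_mem_epoch htJ ht.1
    have h1 := (U.hasFaces k hk t htk).h1Norm_le
      (Crystalline.continuousOn_slice U.continuousOn htJ) (U.boundary_left t htJ)
      (g := fun x => u x t) (Crystalline.continuousOn_slice hx htJ)
      (fun y hy => Crystalline.hasDerivWithinAt_spaceDeriv hu1 hy htJ) (hu.boundary_left t htJ)
    refine h1.trans ?_
    rw [← Real.sqrt_eq_rpow, ← Real.sqrt_mul (by positivity)]
    refine Real.sqrt_le_sqrt ?_
    have h2 : Crystalline.upsilon u U.toFun t = (1 / 2) * ∫ y in (0 : ℝ)..1,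
      |Crystalline.spaceDeriv u y t - derivWithin (fun z => U.toFun z t) (Icc 0 1) y| ^ 2 := rfl
    linarith
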